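/- **Theorem (The open-spot comparison).** Let $E$ be a normed real vector space with metric $d$, let $X\subset E$ be a subset with a base point $x_0\in X$, and let $\varepsilon>0$. Let $t_\varepsilon^-X$ (resp. $t_\varepsilon X$) be the simplicial complex on the set $X$ whose linked parts are the finite subsets $\xi\subset X$ with $d(x,y)<\varepsilon$ (resp. $d(x,y)\le\varepsilon$) for all $x,y\in\xi$, and let $$D_\varepsilon^-X=\{\,y\in E \mid d(x,y)<\varepsilon/2 \text{ for some } x\in X\,\}$$ be the open-spot dilation of $X$. Say that $X$ is $t_\varepsilon^-$-closed (resp. $t_\varepsilon$-closed) if $D_\varepsilon^-X$ contains the convex hull of every linked part of $t_\varepsilon^-X$ (resp. of $t_\varepsilon X$). There is then a continuous map $f_\varepsilon^-:\mathfrak S(t_\varepsilon^-X)\to D_\varepsilon^-X$ (resp. $f_\varepsilon:\mathfrak S(t_\varepsilon X)\to D_\varepsilon^-X$) on the geometric realisation (with the direct limit topology of its simplices) that extends the identity of $X$ and is affine on each simplex. For a simplicial complex $K$ with vertex $x_0$, let $\pi_1(K)$ be its combinatorial fundamental group: maps $a:\mathbb Z\to K$ equal to $x_0$ outside a finite interval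 (so that all $\{a(i),a(i+1)\}$ are linked), modulo homotopies with fixed end points, i.e. maps $A:\mathbb Z^2\to K$ sending each elementary square $\{i,i+1\}\times\{j,j+1\}$ to a linked part, equal to $x_0$ for all $i$ outside a finite interval, and with $A(\cdot,j)=a$ for $j\ll0$, $A(\cdot,j)=b$ for $j\gg0$; the operation is induced by concatenation. Let $\pi_0(K)$ be the set of vertices modulo the equivalence relation generated by "$\{x,y\}$ is linked". Let $\Phi_1:\pi_1(K)\to\pi_1(\mathfrak S K)$ be $[a]\mapsto[\hat a]$, where $\hat a:\mathbb R\to\mathfrak S K$ extends $a$ and is affine on every $[i,i+1]$, and let $\Phi_0:\pi_0(K)\to\pi_0(\mathfrak S K)$ be $[x]\mapsto[x]$. All topological fundamental groups and $\pi_1(K)$ are based at $x_0$. (a) If $X$ is $t_\varepsilon^-$-closed, then $\Phi_1$ (for $K=t_\varepsilon^-X$) and $\pi_1(f_\varepsilon^-)$ are isomorphisms of groups, and so is their composite $$\Psi_1^-=\pi_1(f_\varepsilon^-)\circ\Phi_1:\ \pi_1(t_\varepsilon^-X)\to\pi_1(\mathfrak S(t_\varepsilon^-X))\to\pi_1(D_\varepsilon^-X).$$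 (b) If $X$ is also $t_\varepsilon$-closed, then there is a commutative diagram of isomorphisms of groups $$\begin{array}{ccccc} \pi_1(t_\varepsilon^-X)&\xrightarrow{\ \Phi_1\ }&\pi_1(\mathfrak S(t_\varepsilon^-X))&\xrightarrow{\pi_1(f_\varepsilon^-)}&\pi_1(D_\varepsilon^-X)\\ \downarrow&&\downarrow&&\|\\ \pi_1(t_\varepsilon X)&\xrightarrow{\ \Phi_1\ }&\pi_1(\mathfrak S(t_\varepsilon X))&\xrightarrow{\pi_1(f_\varepsilon)}&\pi_1(D_\varepsilon^-X) \end{array}$$ whose vertical arrows are induced by the inclusion of $t_\varepsilon^-X$ in $t_\varepsilon X$; in particular its lower row $\Psi_1=\pi_1(f_\varepsilon)\circ\Phi_1:\pi_1(t_\varepsilon X)\to\pi_1(D_\varepsilon^-X)$ is an isomorphism. In (a) and (b), the same conclusions hold with $\pi_0$ and $\Phi_0$ in place of $\pi_1$ and $\Phi_1$, with isomorphisms of pointed sets (base-point preserving bijections). -/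

import Mathlib

open Set

noncomputable section

namespace CombSpace

/-! ## Simplicial complexes as combinatorial spaces

Mathlib's `AbstractSimplicialComplex V` is used throughout: its faces are the non-empty linked
parts, and all singletons are faces. -/

section Basic

variable {V W U : Type*}

open Classical in
/-- A morphism of simplicial complexes: a map on vertices which preserves linked parts. -/
def IsMap (K : AbstractSimplicialComplex V) (L : AbstractSimplicialComplex W) (f : V → W) : Prop :=
  ∀ s ∈ K, s.image f ∈ L

theorem IsMap.comp {K : AbstractSimplicialComplex V} {L : AbstractSimplicialComplex W}
    {M : AbstractSimplicialComplex U} {g : W → U} {f : V → W}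
    (hg : IsMap L M g) (hf : IsMap K L f) : IsMap K M (fun v => g (f v)) := by
  classical
  intro s hs
  have h := hg _ (hf s hs)
  rwa [Finset.image_image] at h

theorem IsMap.mono {K : AbstractSimplicialComplex V} {L M : AbstractSimplicialComplex W}
    {f : V → W} (h : L ≤ M) (hf : IsMap K L f) : IsMap K M f :=
  fun s hs => h (hf s hs)

theorem face_of_subset {K : AbstractSimplicialComplex V} {s t : Finset V} (hs : s ∈ K)
    (hts : t ⊆ s) (ht : t.Nonempty) : t ∈ K :=
  (K.isRelLowerSet_faces hs).2 hts ht

theorem isMap_const (K : AbstractSimplicialComplex V) (L : AbstractSimplicialComplex W) (w : W) :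
    IsMap K L (fun _ => w) := by
  classical
  intro s hs
  have hne : s.Nonempty := (K.isRelLowerSet_faces hs).1
  rw [Finset.image_const hne]
  exact L.singleton_mem w

/-- The tolerance set of a reflexive relation (symmetric in all our uses), as a simplicial complex:
a non-empty finite subset is linked iff all its pairs are related. -/
def ofTolerance (r : V → V → Prop) (hr : ∀ x, r x x) : AbstractSimplicialComplex V where
  faces := {s | s.Nonempty ∧ ∀ x ∈ s, ∀ y ∈ s, r x y}
  isRelLowerSet_faces := fun _ hs =>
    ⟨hs.1, fun _ hts ht => ⟨ht, fun x hx y hy => hs.2 x (hts hx) y (hts hy)⟩⟩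
  singleton_mem := fun v => by
    refine ⟨Finset.singleton_nonempty v, ?_⟩
    intro x hx y hy
    rw [Finset.mem_singleton.1 hx, Finset.mem_singleton.1 hy]
    exact hr v

/-- The structure `t_ε X` on a metric space: `x ! y` iff `d(x, y) ≤ ε`. -/
def tol (X : Type*) [MetricSpace X] (ε : ℝ) (hε : 0 < ε) : AbstractSimplicialComplex X :=
  ofTolerance (fun x y => dist x y ≤ ε) (fun x => by rw [dist_self]; exact hε.le)

/-- The structure `t_ε^- X` on a metric space: `x ! y` iff `d(x, y) < ε`. -/
def openTol (X : Type*) [MetricSpace X] (ε : ℝ) (hε : 0 < ε) : AbstractSimplicialComplex X :=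
  ofTolerance (fun x y => dist x y < ε) (fun x => by rw [dist_self]; exact hε)

theorem openTol_le_tol (X : Type*) [MetricSpace X] (ε : ℝ) (hε : 0 < ε) :
    openTol X ε hε ≤ tol X ε hε :=
  fun _ hs => ⟨hs.1, fun x hx y hy => (hs.2 x hx y hy).le⟩

/-- The standard integral line `ℤ`, with the structure generated by the pairs `{i, i+1}`. -/
def line : AbstractSimplicialComplex ℤ where
  faces := {s | s.Nonempty ∧ ∃ i : ℤ, s ⊆ {i, i + 1}}
  isRelLowerSet_faces := fun _ hs =>
    ⟨hs.1, fun _ hts ht => ⟨ht, hs.2.imp fun _ hi => Finset.Subset.trans hts hi⟩⟩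
  singleton_mem := fun v => ⟨Finset.singleton_nonempty v, v, by simp⟩

/-- The standard integral plane `ℤ × ℤ`, with the structure generated by the elementary squares
`{i, i+1} × {j, j+1}`. -/
def plane : AbstractSimplicialComplex (ℤ × ℤ) where
  faces := {s | s.Nonempty ∧ ∃ i j : ℤ, s ⊆ ({i, i + 1} : Finset ℤ) ×ˢ ({j, j + 1} : Finset ℤ)}
  isRelLowerSet_faces := fun _ hs =>
    ⟨hs.1, fun _ hts ht => ⟨ht, hs.2.imp fun _ h => h.imp fun _ hi => Finset.Subset.trans hts hi⟩⟩
  singleton_mem := fun v => ⟨Finset.singleton_nonempty v, v.1, v.2, by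
    intro p hp
    rw [Finset.mem_singleton.1 hp]
    simp⟩

open Classical in
theorem isMap_line_iff {K : AbstractSimplicialComplex V} {a : ℤ → V} :
    IsMap line K a ↔ ∀ i : ℤ, ({a i, a (i + 1)} : Finset V) ∈ K := by
  constructor
  · intro h i
    have h1 := h {i, i + 1} ⟨⟨i, by simp⟩, i, Finset.Subset.refl _⟩
    rwa [Finset.image_insert, Finset.image_singleton] at h1
  · rintro h s ⟨hne, i, hi⟩
    refine face_of_subset (h i) ?_ (hne.image a)
    intro v hv
    obtain ⟨k, hk, rfl⟩ := Finset.mem_image.1 hv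
    have := hi hk
    simp only [Finset.mem_insert, Finset.mem_singleton] at this ⊢
    rcases this with rfl | rfl <;> simp

open Classical in
theorem isMap_plane_iff {K : AbstractSimplicialComplex V} {A : ℤ × ℤ → V} :
    IsMap plane K A ↔ ∀ i j : ℤ,
      ({A (i, j), A (i + 1, j), A (i, j + 1), A (i + 1, j + 1)} : Finset V) ∈ K := by
  constructor
  · intro h i j
    have h1 := h (({i, i + 1} : Finset ℤ) ×ˢ ({j, j + 1} : Finset ℤ))
      ⟨⟨(i, j), by simp⟩, i, j, Finset.Subset.refl _⟩
    refine face_of_subset h1 ?_ ⟨A (i, j), by simp⟩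
    intro v hv
    simp only [Finset.mem_insert, Finset.mem_singleton] at hv
    rw [Finset.mem_image]
    rcases hv with rfl | rfl | rfl | rfl
    · exact ⟨(i, j), by simp, rfl⟩
    · exact ⟨(i + 1, j), by simp, rfl⟩
    · exact ⟨(i, j + 1), by simp, rfl⟩
    · exact ⟨(i + 1, j + 1), by simp, rfl⟩
  · rintro h s ⟨hne, i, j, hij⟩
    refine face_of_subset (h i j) ?_ (hne.image A)
    intro v hv
    obtain ⟨⟨k, l⟩, hk, rfl⟩ := Finset.mem_image.1 hv
    have := hij hk
    simp only [Finset.mem_product, Finset.mem_insert, Finset.mem_singleton] at this ⊢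
    rcases this with ⟨rfl | rfl, rfl | rfl⟩ <;> simp

/-- A map `plane → line` is checked on elementary squares. -/
theorem isMap_plane_line {φ : ℤ × ℤ → ℤ}
    (h : ∀ i j : ℤ, ∃ k : ℤ, (φ (i, j) = k ∨ φ (i, j) = k + 1) ∧
      (φ (i + 1, j) = k ∨ φ (i + 1, j) = k + 1) ∧ (φ (i, j + 1) = k ∨ φ (i, j + 1) = k + 1) ∧
      (φ (i + 1, j + 1) = k ∨ φ (i + 1, j + 1) = k + 1)) : IsMap plane line φ := by
  rw [isMap_plane_iff]
  intro i j
  obtain ⟨k, h1, h2, h3, h4⟩ := h i j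
  refine ⟨⟨φ (i, j), by simp⟩, k, ?_⟩
  intro v hv
  simp only [Finset.mem_insert, Finset.mem_singleton] at hv ⊢
  rcases hv with rfl | rfl | rfl | rfl <;> assumption

/-- A map `line → line` is checked on contiguous pairs. -/
theorem isMap_line_line {φ : ℤ → ℤ}
    (h : ∀ i : ℤ, ∃ k : ℤ, (φ i = k ∨ φ i = k + 1) ∧ (φ (i + 1) = k ∨ φ (i + 1) = k + 1)) :
    IsMap line line φ := by
  rw [isMap_line_iff]
  intro i
  obtain ⟨k, h1, h2⟩ := h i
  refine ⟨⟨φ i, by simp⟩, k, ?_⟩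
  intro v hv
  simp only [Finset.mem_insert, Finset.mem_singleton] at hv ⊢
  rcases hv with rfl | rfl <;> assumption

end Basic

/-! ## The combinatorial `π₀` -/

open Classical in
/-- The set of path components of a simplicial complex: vertices modulo the equivalence relation
generated by `x ! y`, i.e. `{x, y}` is linked. -/
def Pi0 {V : Type*} (K : AbstractSimplicialComplex V) : Type _ :=
  Quot (fun x y : V => ({x, y} : Finset V) ∈ K)

/-- The path component of a vertex. -/
def Pi0.mk {V : Type*} (K : AbstractSimplicialComplex V) (x : V) : Pi0 K := Quot.mk _ x

/-- The map on `π₀` induced by the inclusion of a subobject `K ≺ L` on the same vertices. -/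
def Pi0.incl {V : Type*} {K L : AbstractSimplicialComplex V} (h : K ≤ L) : Pi0 K → Pi0 L :=
  Quot.map id (fun _ _ hxy => h hxy)

/-! ## Loops and the combinatorial fundamental group -/

section Loops

variable {V : Type*} {K L : AbstractSimplicialComplex V} {x : V}

/-- `[m, n]` is an admissible support of the line `a`, as a loop at `x`. -/
def IsSupport (x : V) (a : ℤ → V) (m n : ℤ) : Prop :=
  m ≤ n ∧ (∀ i ≤ m, a i = x) ∧ ∀ i, n ≤ i → a i = x

/-- A combinatorial loop at `x`: a map `a : ℤ → K` which is constant at `x` on the left and on the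
right of some finite interval. -/
structure Loop (K : AbstractSimplicialComplex V) (x : V) where
  toFun : ℤ → V
  isMap : IsMap line K toFun
  supp : ∃ m n : ℤ, IsSupport x toFun m n

/-- Homotopy with fixed end points: a double path `A : ℤ × ℤ → K` (constant outside of a finite
rectangle, in each variable) with horizontal faces `a`, `b` and trivial vertical faces. -/
def Homotopic (a b : Loop K x) : Prop :=
  ∃ A : ℤ × ℤ → V, IsMap plane K A ∧ ∃ m n p q : ℤ, m ≤ n ∧ p ≤ q ∧
    (∀ i j, i ≤ m → A (i, j) = x) ∧ (∀ i j, n ≤ i → A (i, j) = x) ∧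
    (∀ i j, j ≤ p → A (i, j) = a.toFun i) ∧ (∀ i j, q ≤ j → A (i, j) = b.toFun i)

theorem Homotopic.refl (a : Loop K x) : Homotopic a a := by
  obtain ⟨m, n, hmn, hm, hn⟩ := a.supp
  refine ⟨fun p => a.toFun p.1, a.isMap.comp (isMap_plane_line (φ := fun p => p.1) ?_), m, n, 0, 0,
    hmn, le_rfl, fun i _ h => hm i h, fun i _ h => hn i h, fun _ _ _ => rfl, fun _ _ _ => rfl⟩
  intro i j
  exact ⟨i, by simp⟩

theorem Homotopic.symm {a b : Loop K x} (h : Homotopic a b) : Homotopic b a := by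
  classical
  obtain ⟨A, hA, m, n, p, q, hmn, hpq, h1, h2, h3, h4⟩ := h
  refine ⟨fun z => A (z.1, -z.2), ?_, m, n, -q, -p, hmn, by omega, fun i j h => h1 _ _ h,
    fun i j h => h2 _ _ h, fun i j h => h4 _ _ (by omega), fun i j h => h3 _ _ (by omega)⟩
  rw [isMap_plane_iff] at hA ⊢
  intro i j
  refine face_of_subset (hA i (-j - 1)) ?_ (by simp)
  have e1 : -j - 1 + 1 = -j := by ring
  have e2 : -(j + 1) = -j - 1 := by ring
  simp only [e1, e2]
  intro v
  simp only [Finset.mem_insert, Finset.mem_singleton]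
  tauto

theorem Homotopic.trans {a b c : Loop K x} (h : Homotopic a b) (h' : Homotopic b c) :
    Homotopic a c := by
  classical
  obtain ⟨A, hA, m, n, p, q, hmn, hpq, h1, h2, h3, h4⟩ := h
  obtain ⟨B, hB, m', n', p', q', hmn', hpq', h1', h2', h3', h4'⟩ := h'
  have key : ∀ i j, q ≤ j → (if j ≤ q then A (i, j) else B (i, j - q + p')) = B (i, j - q + p') := by
    intro i j hj
    split_ifs with hjq
    · rw [h4 i j hj, h3' i _ (by omega)]
    · rfl
  refine ⟨fun z => if z.2 ≤ q then A z else B (z.1, z.2 - q + p'), ?_, min m m', max n n', p,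
    q + q' - p', by omega, by omega, ?_, ?_, ?_, ?_⟩
  · rw [isMap_plane_iff] at hA hB ⊢
    intro i j
    dsimp only
    by_cases hj : j + 1 ≤ q
    · have hj' : j ≤ q := by omega
      simp only [hj, hj', if_true]
      exact hA i j
    · rw [key _ j (by omega), key _ j (by omega), key _ (j + 1) (by omega),
        key _ (j + 1) (by omega)]
      have e : j + 1 - q + p' = j - q + p' + 1 := by ring
      rw [e]
      exact hB i (j - q + p')
  · intro i j hi
    dsimp only
    split_ifs
    · exact h1 _ _ (by omega)
    · exact h1' _ _ (by omega)
  · intro i j hi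
    dsimp only
    split_ifs
    · exact h2 _ _ (by omega)
    · exact h2' _ _ (by omega)
  · intro i j hj
    dsimp only
    rw [if_pos (by omega)]
    exact h3 _ _ hj
  · intro i j hj
    dsimp only
    rw [key _ _ (by omega)]
    exact h4' _ _ (by omega)

/-- Loops modulo homotopy with fixed end points. -/
@[reducible]
def loopSetoid (K : AbstractSimplicialComplex V) (x : V) : Setoid (Loop K x) where
  r := Homotopic
  iseqv := ⟨Homotopic.refl, Homotopic.symm, Homotopic.trans⟩

/-- The underlying set of the combinatorial fundamental group. -/
def Pi1 (K : AbstractSimplicialComplex V) (x : V) : Type _ := Quotient (loopSetoid K x)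

/-- The class of a loop. -/
def Pi1.mk (a : Loop K x) : Pi1 K x := Quotient.mk (loopSetoid K x) a

theorem Pi1.sound {a b : Loop K x} (h : Homotopic a b) : Pi1.mk a = Pi1.mk b :=
  Quotient.sound h

/-- The concatenation of `a` (constant from `n` on) and `b` (constant up to `m`), pasted
at `n + m`. -/
def concatFun (a b : ℤ → V) (n m : ℤ) : ℤ → V :=
  fun i => if i ≤ n + m then a (i - m) else b (i - n)

theorem concatFun_right {a b : ℤ → V} {n m i : ℤ} (ha : ∀ i, n ≤ i → a i = x)
    (hb : ∀ i ≤ m, b i = x) (hi : n + m ≤ i) : concatFun a b n m i = b (i - n) := by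
  unfold concatFun
  split_ifs with h
  · rw [ha _ (by omega), hb _ (by omega)]
  · rfl

/-- The (admissible) concatenation of two loops: first `a`, then `b`. -/
def Loop.concat (a b : Loop K x) (n m : ℤ) (ha : ∀ i, n ≤ i → a.toFun i = x)
    (hb : ∀ i ≤ m, b.toFun i = x) : Loop K x where
  toFun := concatFun a.toFun b.toFun n m
  isMap := by
    classical
    have h1 := isMap_line_iff.1 a.isMap
    have h2 := isMap_line_iff.1 b.isMap
    rw [isMap_line_iff]
    intro i
    by_cases hi : i + 1 ≤ n + m
    · have hi' : i ≤ n + m := by omega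
      have e : i + 1 - m = i - m + 1 := by ring
      simp only [concatFun, hi, hi', if_true, e]
      exact h1 _
    · rw [concatFun_right ha hb (by omega), concatFun_right ha hb (by omega)]
      have e : i + 1 - n = i - n + 1 := by ring
      rw [e]
      exact h2 _
  supp := by
    obtain ⟨m₁, n₁, _, h1, _⟩ := a.supp
    obtain ⟨m₂, n₂, _, _, h2⟩ := b.supp
    refine ⟨min (m₁ + m) (n + m), max (n₂ + n) (n + m), by omega, ?_, ?_⟩
    · intro i hi
      rw [concatFun, if_pos (by omega)]
      exact h1 _ (by omega)
    · intro i hi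
      rw [concatFun_right ha hb (by omega)]
      exact h2 _ (by omega)

/-- The elementary delay at `t`. -/
def delay (t i : ℤ) : ℤ := if i ≤ t then i else i - 1

/-- A loop precomposed with an elementary delay. -/
def Loop.delayed (a : Loop K x) (t : ℤ) : Loop K x where
  toFun := fun i => a.toFun (delay t i)
  isMap := a.isMap.comp (isMap_line_line fun i => by
    unfold delay
    refine ⟨if i ≤ t then i else i - 1, ?_⟩
    split_ifs <;> omega)
  supp := by
    obtain ⟨m, n, hmn, h1, h2⟩ := a.supp
    refine ⟨m, n + 1, by omega, ?_, ?_⟩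
    · intro i hi
      exact h1 _ (by unfold delay; split_ifs <;> omega)
    · intro i hi
      exact h2 _ (by unfold delay; split_ifs <;> omega)

theorem Loop.delayed_homotopic (a : Loop K x) (t : ℤ) : Homotopic (a.delayed t) a := by
  obtain ⟨m, n, hmn, h1, h2⟩ := a.supp
  refine ⟨fun z => a.toFun (delay (max t z.2) z.1), a.isMap.comp (isMap_plane_line
    (φ := fun z => delay (max t z.2) z.1) ?_), m, n + 1, t, max t n, by omega, by omega,
    ?_, ?_, ?_, ?_⟩
  · intro i j
    dsimp only [delay]
    refine ⟨if i ≤ max t j then i else i - 1, ?_⟩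
    split_ifs <;> omega
  · intro i j hi
    exact h1 _ (by dsimp only [delay]; split_ifs <;> omega)
  · intro i j hi
    exact h2 _ (by dsimp only [delay]; split_ifs <;> omega)
  · intro i j hj
    dsimp only [Loop.delayed]
    rw [max_eq_left hj]
  · intro i j hj
    dsimp only [delay]
    split_ifs with h
    · rfl
    · rw [h2 _ (by omega), h2 _ (by omega)]

theorem Loop.ext {a b : Loop K x} (h : ∀ i, a.toFun i = b.toFun i) : a = b := by
  cases a
  cases b
  congr
  exact funext h

theorem mk_concat_succ_left (a b : Loop K x) {n m : ℤ} (ha : ∀ i, n ≤ i → a.toFun i = x)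
    (hb : ∀ i ≤ m, b.toFun i = x) :
    Pi1.mk (a.concat b (n + 1) m (fun i hi => ha i (by omega)) hb) =
      Pi1.mk (a.concat b n m ha hb) := by
  rw [← Pi1.sound ((a.concat b n m ha hb).delayed_homotopic (n + m))]
  congr 1
  refine Loop.ext fun i => ?_
  dsimp only [Loop.concat, Loop.delayed, concatFun, delay]
  by_cases h1 : i ≤ n + m
  · simp only [h1, show i ≤ n + 1 + m by omega, if_true]
  · by_cases h2 : i ≤ n + m + 1
    · simp only [h1, show i ≤ n + 1 + m by omega, show i - 1 ≤ n + m by omega, if_true, if_false]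
      rw [ha _ (by omega), ha _ (by omega)]
    · simp only [h1, show ¬ i ≤ n + 1 + m by omega, show ¬ i - 1 ≤ n + m by omega, if_false]
      congr 1
      ring

theorem mk_concat_pred_right (a b : Loop K x) {n m : ℤ} (ha : ∀ i, n ≤ i → a.toFun i = x)
    (hb : ∀ i ≤ m, b.toFun i = x) :
    Pi1.mk (a.concat b n (m - 1) ha (fun i hi => hb i (by omega))) =
      Pi1.mk (a.concat b n m ha hb) := by
  rw [← mk_concat_succ_left a b ha hb]
  obtain ⟨m₁, n₁, _, h1, _⟩ := a.supp
  rw [← Pi1.sound ((a.concat b n (m - 1) ha (fun i hi => hb i (by omega))).delayed_homotopic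
    (min (m₁ + m - 1) (n + m - 1)))]
  congr 1
  refine Loop.ext fun i => ?_
  dsimp only [Loop.concat, Loop.delayed, concatFun, delay]
  by_cases hi : i ≤ min (m₁ + m - 1) (n + m - 1)
  · rw [if_pos (by omega), if_pos (by omega), if_pos (by omega), h1 _ (by omega), h1 _ (by omega)]
  · rw [if_neg hi]
    rcases lt_trichotomy i (n + m + 1) with h | h | h
    · rw [if_pos (by omega), if_pos (by omega)]
      congr 1
      ring
    · rw [if_neg (by omega), if_pos (by omega), ha _ (by omega), hb _ (by omega)]
    · rw [if_neg (by omega), if_neg (by omega)]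
      congr 1
      ring

theorem mk_concat_left (a b : Loop K x) {n n' m : ℤ} (ha : ∀ i, n ≤ i → a.toFun i = x)
    (hb : ∀ i ≤ m, b.toFun i = x) (h : n ≤ n') :
    Pi1.mk (a.concat b n' m (fun i hi => ha i (by omega)) hb) =
      Pi1.mk (a.concat b n m ha hb) := by
  induction n', h using Int.leInduction with
  | base => rfl
  | succ k hk ih => rw [mk_concat_succ_left a b (fun i hi => ha i (by omega)) hb, ih]

theorem mk_concat_right (a b : Loop K x) {n m m' : ℤ} (ha : ∀ i, n ≤ i → a.toFun i = x)
    (hb : ∀ i ≤ m, b.toFun i = x) (h : m' ≤ m) :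
    Pi1.mk (a.concat b n m' ha (fun i hi => hb i (by omega))) =
      Pi1.mk (a.concat b n m ha hb) := by
  induction m', h using Int.leInductionDown with
  | base => rfl
  | pred k hk ih => rw [mk_concat_pred_right a b ha (fun i hi => hb i (by omega)), ih]

/-- All admissible concatenations of two loops are homotopic. -/
theorem mk_concat_congr (a b : Loop K x) {n m n' m' : ℤ} (ha : ∀ i, n ≤ i → a.toFun i = x)
    (hb : ∀ i ≤ m, b.toFun i = x) (ha' : ∀ i, n' ≤ i → a.toFun i = x)
    (hb' : ∀ i ≤ m', b.toFun i = x) :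
    Pi1.mk (a.concat b n m ha hb) = Pi1.mk (a.concat b n' m' ha' hb') := by
  rw [← mk_concat_left a b ha hb (le_max_left n n'),
    ← mk_concat_left a b ha' hb' (le_max_right n n'),
    ← mk_concat_right a b _ hb (min_le_left m m'), ← mk_concat_right a b _ hb' (min_le_right m m')]

theorem concat_homotopic {a a' b b' : Loop K x} (h : Homotopic a a') (h' : Homotopic b b') :
    ∃ (n m : ℤ) (ha : ∀ i, n ≤ i → a.toFun i = x) (ha' : ∀ i, n ≤ i → a'.toFun i = x)
      (hb : ∀ i ≤ m, b.toFun i = x) (hb' : ∀ i ≤ m, b'.toFun i = x),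
      Homotopic (a.concat b n m ha hb) (a'.concat b' n m ha' hb') := by
  classical
  obtain ⟨A, hA, m, n, p, q, hmn, hpq, h1, h2, h3, h4⟩ := h
  obtain ⟨B, hB, m', n', p', q', hmn', hpq', h1', h2', h3', h4'⟩ := h'
  refine ⟨n, m', fun i hi => by rw [← h3 i p le_rfl, h2 i p hi],
    fun i hi => by rw [← h4 i q le_rfl, h2 i q hi],
    fun i hi => by rw [← h3' i p' le_rfl, h1' i p' hi],
    fun i hi => by rw [← h4' i q' le_rfl, h1' i q' hi],
    fun z => concatFun (fun i => A (i, z.2)) (fun i => B (i, z.2)) n m' z.1, ?_,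
    min (m + m') (n + m'), max (n' + n) (n + m'), min p p', max q q', by omega, by omega,
    ?_, ?_, ?_, ?_⟩
  · rw [isMap_plane_iff] at hA hB ⊢
    intro i j
    dsimp only
    by_cases hi : i + 1 ≤ n + m'
    · have hi' : i ≤ n + m' := by omega
      have e : i + 1 - m' = i - m' + 1 := by ring
      simp only [concatFun, hi, hi', if_true, e]
      exact hA _ _
    · have key : ∀ i j, n + m' ≤ i →
          concatFun (fun i => A (i, j)) (fun i => B (i, j)) n m' i = B (i - n, j) :=
        fun i j hi => concatFun_right (x := x) (fun i hi => h2 i j hi) (fun i hi => h1' i j hi) hi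
      rw [key _ _ (by omega), key _ _ (by omega), key _ _ (by omega), key _ _ (by omega)]
      have e : i + 1 - n = i - n + 1 := by ring
      rw [e]
      exact hB _ _
  · intro i j hi
    dsimp only [concatFun]
    rw [if_pos (by omega)]
    exact h1 _ _ (by omega)
  · intro i j hi
    dsimp only
    rw [concatFun_right (x := x) (fun i hi => h2 i j hi) (fun i hi => h1' i j hi) (by omega)]
    exact h2' _ _ (by omega)
  · intro i j hj
    dsimp only [concatFun, Loop.concat]
    rw [h3 _ _ (by omega), h3' _ _ (by omega)]
  · intro i j hj
    dsimp only [concatFun, Loop.concat]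
    rw [h4 _ _ (by omega), h4' _ _ (by omega)]

theorem Loop.exists_right (a : Loop K x) : ∃ n : ℤ, ∀ i, n ≤ i → a.toFun i = x :=
  let ⟨_, n, h⟩ := a.supp
  ⟨n, h.2.2⟩

theorem Loop.exists_left (a : Loop K x) : ∃ m : ℤ, ∀ i ≤ m, a.toFun i = x :=
  let ⟨m, _, h⟩ := a.supp
  ⟨m, h.2.1⟩

/-- The product of two classes. As in Mathlib's `FundamentalGroup`, products are written in
composition order: in `g * h` the loop `h` is run first. -/
instance : Mul (Pi1 K x) where
  mul g h := Quotient.liftOn₂ g h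
    (fun a b => Pi1.mk (b.concat a b.exists_right.choose a.exists_left.choose
      b.exists_right.choose_spec a.exists_left.choose_spec))
    (by
      intro a b a' b' ha hb
      obtain ⟨n, m, h1, h2, h3, h4, h5⟩ := concat_homotopic hb ha
      rw [mk_concat_congr b a _ _ h1 h3, mk_concat_congr b' a' _ _ h2 h4]
      exact Pi1.sound h5)

theorem Pi1.mk_mul_mk (a b : Loop K x) {n m : ℤ} (hb : ∀ i, n ≤ i → b.toFun i = x)
    (ha : ∀ i ≤ m, a.toFun i = x) :
    Pi1.mk a * Pi1.mk b = Pi1.mk (b.concat a n m hb ha) :=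
  mk_concat_congr b a _ _ hb ha

/-- The constant loop. -/
def Loop.const (K : AbstractSimplicialComplex V) (x : V) : Loop K x where
  toFun := fun _ => x
  isMap := isMap_const _ _ x
  supp := ⟨0, 0, le_rfl, fun _ _ => rfl, fun _ _ => rfl⟩

/-- The reversed loop. -/
def Loop.reverse (a : Loop K x) : Loop K x where
  toFun := fun i => a.toFun (-i)
  isMap := a.isMap.comp (isMap_line_line fun i => ⟨-i - 1, by omega, by omega⟩)
  supp := by
    obtain ⟨m, n, hmn, h1, h2⟩ := a.supp
    exact ⟨-n, -m, by omega, fun i hi => h2 _ (by omega), fun i hi => h1 _ (by omega)⟩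

theorem Loop.reverse_homotopic {a b : Loop K x} (h : Homotopic a b) :
    Homotopic a.reverse b.reverse := by
  classical
  obtain ⟨A, hA, m, n, p, q, hmn, hpq, h1, h2, h3, h4⟩ := h
  refine ⟨fun z => A (-z.1, z.2), ?_, -n, -m, p, q, by omega, hpq, fun i j h => h2 _ _ (by omega),
    fun i j h => h1 _ _ (by omega), fun i j h => h3 _ _ h, fun i j h => h4 _ _ h⟩
  rw [isMap_plane_iff] at hA ⊢
  intro i j
  refine face_of_subset (hA (-i - 1) j) ?_ (by simp)
  have e1 : -i - 1 + 1 = -i := by ring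
  have e2 : -(i + 1) = -i - 1 := by ring
  simp only [e1, e2]
  intro v
  simp only [Finset.mem_insert, Finset.mem_singleton]
  tauto

theorem concat_reverse_homotopic (a : Loop K x) {n : ℤ} (ha : ∀ i, n ≤ i → a.toFun i = x)
    (ha' : ∀ i ≤ -n, a.reverse.toFun i = x) :
    Homotopic (a.concat a.reverse n (-n) ha ha') (Loop.const K x) := by
  obtain ⟨m, n₁, hmn, h1, h2⟩ := a.supp
  refine ⟨fun z => a.toFun (n - max |z.1| z.2), a.isMap.comp (isMap_plane_line
    (φ := fun z => n - max |z.1| z.2) ?_), min 0 (m - n), max 0 (n - m), 0, max 0 (n - m),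
    by omega, by omega, ?_, ?_, ?_, ?_⟩
  · intro i j
    dsimp only
    refine ⟨n - max |i| j - (if max |i| j < max |i + 1| (j + 1) then 1 else 0), ?_⟩
    rcases abs_cases i with h | h <;> rcases abs_cases (i + 1) with h' | h' <;>
      split_ifs <;> omega
  · intro i j hi
    refine h1 _ ?_
    dsimp only
    rcases abs_cases i with h | h <;> omega
  · intro i j hi
    refine h1 _ ?_
    dsimp only
    rcases abs_cases i with h | h <;> omega
  · intro i j hj
    dsimp only [Loop.concat, Loop.reverse, concatFun]
    split_ifs with h
    · congr 1
      rcases abs_cases i with h | h <;> omega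
    · congr 1
      rcases abs_cases i with h | h <;> omega
  · intro i j hj
    exact h1 _ (by omega)

instance : One (Pi1 K x) := ⟨Pi1.mk (Loop.const K x)⟩

instance : Inv (Pi1 K x) where
  inv g := Quotient.liftOn g (fun a => Pi1.mk a.reverse)
    (fun _ _ h => Pi1.sound (Loop.reverse_homotopic h))

/-- The combinatorial fundamental group of a pointed simplicial complex. -/
instance : Group (Pi1 K x) := Group.ofLeftAxioms
  (by
    rintro ⟨a⟩ ⟨b⟩ ⟨c⟩
    change Pi1.mk a * Pi1.mk b * Pi1.mk c = Pi1.mk a * (Pi1.mk b * Pi1.mk c)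
    obtain ⟨m₁, n₁, -, h1, -⟩ := a.supp
    obtain ⟨m₂, n₂, hmn, h2, h2'⟩ := b.supp
    obtain ⟨m₃, n₃, -, -, h3⟩ := c.supp
    rw [Pi1.mk_mul_mk a b h2' h1, Pi1.mk_mul_mk b c h3 h2,
      Pi1.mk_mul_mk (n := n₃) (m := m₂ + m₁) _ c h3 ?_,
      Pi1.mk_mul_mk (n := n₃ + n₂) (m := m₁) a _ ?_ h1]
    · congr 1
      refine Loop.ext fun i => ?_
      dsimp only [Loop.concat, concatFun]
      split_ifs <;> first | omega | (congr 1; omega)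
    · intro i hi
      dsimp only [Loop.concat]
      rw [concatFun_right h3 h2 (by omega)]
      exact h2' _ (by omega)
    · intro i hi
      dsimp only [Loop.concat, concatFun]
      rw [if_pos (by omega)]
      exact h2 _ (by omega))
  (by
    rintro ⟨a⟩
    change Pi1.mk (Loop.const K x) * Pi1.mk a = Pi1.mk a
    obtain ⟨m, n, -, -, h⟩ := a.supp
    rw [Pi1.mk_mul_mk (m := 0) (Loop.const K x) a h (fun _ _ => rfl)]
    congr 1
    refine Loop.ext fun i => ?_
    dsimp only [Loop.concat, concatFun, Loop.const]
    split_ifs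
    · congr 1
      omega
    · rw [h _ (by omega)])
  (by
    rintro ⟨a⟩
    change Pi1.mk a.reverse * Pi1.mk a = Pi1.mk (Loop.const K x)
    obtain ⟨m, n, -, -, h⟩ := a.supp
    have h' : ∀ i ≤ -n, a.reverse.toFun i = x := fun i hi => h _ (by omega)
    rw [Pi1.mk_mul_mk a.reverse a h h']
    exact Pi1.sound (concat_reverse_homotopic a h h'))

/-- A loop of a subobject `K ≺ L`, as a loop of `L`. -/
def Loop.incl (h : K ≤ L) (a : Loop K x) : Loop L x where
  toFun := a.toFun
  isMap := a.isMap.mono h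
  supp := a.supp

/-- The map on classes of loops induced by the inclusion of a subobject `K ≺ L` on the same
vertices. -/
def Pi1.inclFun (h : K ≤ L) (g : Pi1 K x) : Pi1 L x :=
  Quotient.liftOn g (fun a => Pi1.mk (a.incl h))
    (fun _ _ ⟨A, hA, hA'⟩ => Pi1.sound ⟨A, hA.mono h, hA'⟩)

/-- The homomorphism on fundamental groups induced by the inclusion of a subobject `K ≺ L` on the
same vertices. -/
def Pi1.incl (h : K ≤ L) (x : V) : Pi1 K x →* Pi1 L x where
  toFun := Pi1.inclFun h
  map_one' := rfl
  map_mul' := by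
    rintro ⟨a⟩ ⟨b⟩
    obtain ⟨n, hn⟩ := b.exists_right
    obtain ⟨m, hm⟩ := a.exists_left
    exact (congrArg (Pi1.inclFun h) (Pi1.mk_mul_mk a b hn hm)).trans
      (Pi1.mk_mul_mk (a.incl h) (b.incl h) hn hm).symm

end Loops

/-! ## The geometric realisation -/

section Realization

variable {V : Type*}

/-- The points of the geometric realisation `𝔖(K)`: convex combinations `∑ λ_v v` of vertices, with
linked support. -/
@[ext]
structure Realization (K : AbstractSimplicialComplex V) where
  weight : V →₀ ℝ
  nonneg : ∀ v, 0 ≤ weight v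
  support_mem : weight.support ∈ K
  sum_eq_one : weight.sum (fun _ r => r) = 1

variable {K L : AbstractSimplicialComplex V} {x : V}

theorem support_mem_of_subset {w : V →₀ ℝ} {s : Finset V} (hs : s ∈ K) (hw : w.support ⊆ s)
    (h1 : w.sum (fun _ r => r) = 1) : w.support ∈ K := by
  refine face_of_subset hs hw ?_
  rw [Finset.nonempty_iff_ne_empty]
  intro h
  rw [Finsupp.support_eq_empty] at h
  rw [h, Finsupp.sum_zero_index] at h1
  exact zero_ne_one h1

open Classical in
/-- The finitely supported function on `V` with given values on `s`. -/
def extendWeight (s : Finset V) (t : s → ℝ) : V →₀ ℝ :=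
  Finsupp.onFinset s (fun v => if h : v ∈ s then t ⟨v, h⟩ else 0) (by
    intro v hv
    by_contra h
    rw [dif_neg h] at hv
    exact hv rfl)

theorem extendWeight_sum {M : Type*} [AddCommMonoid M] (s : Finset V) (t : s → ℝ) (g : V → ℝ → M)
    (hg : ∀ v, g v 0 = 0) :
    (extendWeight s t).sum g = ∑ v : s, g v (t v) := by
  classical
  rw [extendWeight, Finsupp.onFinset_sum _ hg, ← Finset.sum_coe_sort s]
  refine Finset.sum_congr rfl fun v _ => ?_
  rw [dif_pos v.2]

/-- The simplex `Δ(s)` of the realisation spanned by a linked part `s`, parametrised by the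
standard simplex on `s`. -/
def Realization.simplex (K : AbstractSimplicialComplex V) (s : Finset V) (hs : s ∈ K)
    (t : stdSimplex ℝ s) : Realization K where
  weight := extendWeight s t.1
  nonneg := fun v => by
    classical
    rw [extendWeight, Finsupp.onFinset_apply]
    split_ifs with h
    · exact t.2.1 _
    · exact le_rfl
  support_mem := support_mem_of_subset hs Finsupp.support_onFinset_subset
    ((extendWeight_sum s t.1 _ fun _ => rfl).trans t.2.2)
  sum_eq_one := (extendWeight_sum s t.1 _ fun _ => rfl).trans t.2.2

/-- The direct limit topology: `𝔖(K)` has the final topology of its simplices `Δ(s)`, with their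
euclidean topology. -/
instance : TopologicalSpace (Realization K) :=
  ⨆ s : {s : Finset V // s ∈ K},
    TopologicalSpace.coinduced (Realization.simplex K s.1 s.2) inferInstance

theorem continuous_simplex (s : Finset V) (hs : s ∈ K) :
    Continuous (Realization.simplex K s hs) := by
  rw [continuous_iff_coinduced_le]
  exact le_iSup (fun s : {s : Finset V // s ∈ K} =>
    TopologicalSpace.coinduced (Realization.simplex K s.1 s.2) inferInstance) ⟨s, hs⟩

theorem continuous_realization {Y : Type*} [TopologicalSpace Y] {f : Realization K → Y}
    (h : ∀ s hs, Continuous fun t => f (Realization.simplex K s hs t)) : Continuous f := by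
  rw [continuous_iSup_dom]
  intro s
  rw [continuous_coinduced_dom]
  exact h s.1 s.2

/-- A vertex of `K`, as a point of the realisation. -/
def Realization.vertex (K : AbstractSimplicialComplex V) (v : V) : Realization K where
  weight := Finsupp.single v 1
  nonneg := fun u => by
    classical
    rw [Finsupp.single_apply]
    split_ifs <;> norm_num
  support_mem := support_mem_of_subset (K.singleton_mem v) Finsupp.support_single_subset
    (Finsupp.sum_single_index rfl)
  sum_eq_one := Finsupp.sum_single_index rfl

/-- The inclusion of realisations induced by the inclusion of a subobject `K ≺ L` on the same
vertices. -/
def Realization.incl (h : K ≤ L) : C(Realization K, Realization L) where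
  toFun p := ⟨p.weight, p.nonneg, h p.support_mem, p.sum_eq_one⟩
  continuous_toFun := continuous_realization fun s hs => continuous_simplex (K := L) s (h hs)

open Classical in
/-- The point `(1 - r) u + r v` of the edge of two linked vertices. -/
def Realization.edge (u v : V) (h : ({u, v} : Finset V) ∈ K) (r : ℝ) (hr : r ∈ Icc (0 : ℝ) 1) :
    Realization K where
  weight := Finsupp.single u (1 - r) + Finsupp.single v r
  nonneg := fun w => by
    rw [Finsupp.add_apply, Finsupp.single_apply, Finsupp.single_apply]
    have h0 := hr.1
    have h1 := hr.2
    split_ifs <;> linarith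
  support_mem := by
    refine support_mem_of_subset h ?_ ?_
    · intro w hw
      rw [Finsupp.mem_support_iff, Finsupp.add_apply, Finsupp.single_apply,
        Finsupp.single_apply] at hw
      simp only [Finset.mem_insert, Finset.mem_singleton]
      by_contra hc
      push Not at hc
      rw [if_neg hc.1.symm, if_neg hc.2.symm] at hw
      simp at hw
    · rw [Finsupp.sum_add_index' (fun _ => rfl) (fun _ _ _ => rfl), Finsupp.sum_single_index rfl,
        Finsupp.sum_single_index rfl]
      ring
  sum_eq_one := by
    rw [Finsupp.sum_add_index' (fun _ => rfl) (fun _ _ _ => rfl), Finsupp.sum_single_index rfl,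
      Finsupp.sum_single_index rfl]
    ring

open Classical in
theorem continuous_edge (u v : V) (h : ({u, v} : Finset V) ∈ K) :
    Continuous fun r : Icc (0 : ℝ) 1 => Realization.edge u v h r.1 r.2 := by
  have hu : u ∈ ({u, v} : Finset V) := by simp
  have hv : v ∈ ({u, v} : Finset V) := by simp
  let w : Icc (0 : ℝ) 1 → ({u, v} : Finset V) → ℝ := fun r z =>
    (if u = z.1 then 1 - r.1 else 0) + (if v = z.1 then r.1 else 0)
  have hw : ∀ r, w r ∈ stdSimplex ℝ ({u, v} : Finset V) := by
    intro r
    have h0 := r.2.1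
    have h1 := r.2.2
    constructor
    · intro z
      dsimp only [w]
      split_ifs <;> linarith
    · dsimp only [w]
      rw [Finset.sum_coe_sort ({u, v} : Finset V)
        (fun z => (if u = z then 1 - r.1 else 0) + (if v = z then r.1 else 0)),
        Finset.sum_add_distrib, Finset.sum_ite_eq, Finset.sum_ite_eq, if_pos hu, if_pos hv]
      ring
  have hc : Continuous fun r => (⟨w r, hw r⟩ : stdSimplex ℝ ({u, v} : Finset V)) := by
    refine Continuous.subtype_mk (continuous_pi fun z => ?_) _
    dsimp only [w]
    split_ifs <;> fun_prop
  refine ((continuous_simplex _ h).comp hc).congr fun r => ?_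
  refine Realization.ext (Finsupp.ext fun z => ?_)
  dsimp only [Realization.simplex, Realization.edge, Function.comp, extendWeight, w]
  rw [Finsupp.onFinset_apply, Finsupp.add_apply, Finsupp.single_apply, Finsupp.single_apply]
  split_ifs with h1 h2 h3 h4 h5 <;> simp_all

/-- The extension `â : ℝ → 𝔖(K)` of a loop `a : ℤ → K`, affine on each interval `[i, i+1]`. -/
def Loop.hat (a : Loop K x) (t : ℝ) : Realization K :=
  Realization.edge (a.toFun ⌊t⌋) (a.toFun (⌊t⌋ + 1)) (isMap_line_iff.1 a.isMap ⌊t⌋) (Int.fract t)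
    ⟨Int.fract_nonneg t, (Int.fract_lt_one t).le⟩

theorem Loop.hat_intCast (a : Loop K x) (i : ℤ) :
    a.hat i = Realization.vertex K (a.toFun i) := by
  refine Realization.ext ?_
  simp [Loop.hat, Realization.edge, Realization.vertex]

theorem Loop.continuous_hat (a : Loop K x) : Continuous a.hat := by
  classical
  have hlf : LocallyFinite fun k : ℤ => Icc (k : ℝ) ((k : ℝ) + 1) := by
    intro t
    refine ⟨Ioo (t - 1) (t + 1), Ioo_mem_nhds (by linarith) (by linarith),
      (Set.finite_Icc (⌊t⌋ - 3) (⌊t⌋ + 3)).subset ?_⟩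
    rintro k ⟨s, hs1, hs2⟩
    have h1 := Int.floor_le t
    have h2 := Int.lt_floor_add_one t
    constructor
    · have : ((⌊t⌋ - 3 : ℤ) : ℝ) ≤ k := by
        push_cast
        linarith [hs1.1, hs1.2, hs2.1, hs2.2]
      exact_mod_cast this
    · have : (k : ℝ) ≤ ((⌊t⌋ + 3 : ℤ) : ℝ) := by
        push_cast
        linarith [hs1.1, hs1.2, hs2.1, hs2.2]
      exact_mod_cast this
  refine hlf.continuous ?_ (fun _ => isClosed_Icc) ?_
  · rw [Set.eq_univ_iff_forall]
    intro t
    exact Set.mem_iUnion.2 ⟨⌊t⌋, Int.floor_le t, (Int.lt_floor_add_one t).le⟩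
  · intro k
    have hc : Continuous fun t : ℝ => Realization.edge (a.toFun k) (a.toFun (k + 1))
        (isMap_line_iff.1 a.isMap k) (Set.projIcc (0 : ℝ) 1 zero_le_one (t - k)).1
        (Set.projIcc (0 : ℝ) 1 zero_le_one (t - k)).2 :=
      (continuous_edge _ _ (isMap_line_iff.1 a.isMap k)).comp
        (continuous_projIcc.comp (continuous_id.sub continuous_const))
    refine hc.continuousOn.congr ?_
    intro t ht
    have hmem : t - k ∈ Icc (0 : ℝ) 1 := ⟨by linarith [ht.1], by linarith [ht.2]⟩
    dsimp only
    rcases eq_or_lt_of_le ht.2 with he | hlt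
    · have ht' : t = ((k + 1 : ℤ) : ℝ) := by
        push_cast
        exact he
      have hp : (Set.projIcc (0 : ℝ) 1 zero_le_one (t - k)).1 = 1 := by
        rw [Set.projIcc_of_mem _ hmem]
        dsimp only
        linarith
      refine Realization.ext ?_
      rw [ht', Loop.hat_intCast, ← ht']
      simp only [Realization.edge, Realization.vertex, hp]
      simp
    · have hf : ⌊t⌋ = k := Int.floor_eq_iff.2 ⟨ht.1, hlt⟩
      have hp : (Set.projIcc (0 : ℝ) 1 zero_le_one (t - k)).1 = t - k := by
        rw [Set.projIcc_of_mem _ hmem]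
      refine Realization.ext ?_
      simp only [Loop.hat, Realization.edge, hp, Int.fract, hf]

/-- The topological loop given by `â` on an admissible support `[m, n]`, linearly reparametrised
over the unit interval. -/
def Loop.toPath (a : Loop K x) (m n : ℤ) (h : IsSupport x a.toFun m n) :
    Path (Realization.vertex K x) (Realization.vertex K x) where
  toFun t := a.hat ((m : ℝ) + t * ((n : ℝ) - m))
  continuous_toFun := a.continuous_hat.comp (by fun_prop)
  source' := by
    rw [show (m : ℝ) + ((0 : unitInterval) : ℝ) * ((n : ℝ) - m) = m by simp, Loop.hat_intCast,
      h.2.1 m le_rfl]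
  target' := by
    rw [show (m : ℝ) + ((1 : unitInterval) : ℝ) * ((n : ℝ) - m) = n by simp, Loop.hat_intCast,
      h.2.2 n le_rfl]

/-- `Φ` is the geometric comparison `π₁(K) → π₁(𝔖(K))`, `[a] ↦ [â]`. -/
def IsComparison (Φ : Pi1 K x ≃* FundamentalGroup (Realization K) (Realization.vertex K x)) :
    Prop :=
  ∀ (a : Loop K x) (m n : ℤ) (h : IsSupport x a.toFun m n),
    Φ (Pi1.mk a) = FundamentalGroup.fromPath (Path.Homotopic.Quotient.mk (a.toPath m n h))

/-- The map on path components induced by a continuous map. -/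
def pi0Map {Y Z : Type*} [TopologicalSpace Y] [TopologicalSpace Z] (f : C(Y, Z)) :
    ZerothHomotopy Y → ZerothHomotopy Z :=
  ZerothHomotopy.lift (fun y => ZerothHomotopy.mk (f y))
    (fun _ _ p => ZerothHomotopy.sound (p.map f.continuous))

end Realization

/-! ## Spot dilations -/

section Dilation

variable {E : Type*} [NormedAddCommGroup E]

/-- The open-spot dilation `D_ε^-(X)`: the union of the open balls of radius `ε/2` centred
in `X`. -/
def openDilation (X : Set E) (ε : ℝ) : Set E :=
  {y | ∃ x ∈ X, dist x y < ε / 2}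

theorem subset_openDilation (X : Set E) {ε : ℝ} (hε : 0 < ε) : X ⊆ openDilation X ε :=
  fun x hx => ⟨x, hx, by rw [dist_self]; exact half_pos hε⟩

variable [NormedSpace ℝ E]

/-- The open-spot dilation `D_ε^-(X)` contains the convex envelope of every linked part of `K`, a
simplicial complex on the set `X`. For `K = t_ε^- X` (resp. `K = t_ε X`) this says that `X` is
`t_ε^-`-closed (resp. `t_ε`-closed). -/
def IsHullClosed (X : Set E) (ε : ℝ) (K : AbstractSimplicialComplex X) : Prop :=
  ∀ s ∈ K, convexHull ℝ ((fun v : X => (v : E)) '' (s : Set X)) ⊆ openDilation X ε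

/-- `X` is `t_ε^-`-closed. -/
def IsOpenTolClosed (X : Set E) (ε : ℝ) (hε : 0 < ε) : Prop :=
  IsHullClosed X ε (openTol X ε hε)

/-- `X` is `t_ε`-closed. -/
def IsTolClosed (X : Set E) (ε : ℝ) (hε : 0 < ε) : Prop :=
  IsHullClosed X ε (tol X ε hε)

theorem IsTolClosed.isOpenTolClosed {X : Set E} {ε : ℝ} {hε : 0 < ε} (h : IsTolClosed X ε hε) :
    IsOpenTolClosed X ε hε :=
  fun s hs => h s (openTol_le_tol X ε hε hs)

variable {X : Set E} {ε : ℝ} {K : AbstractSimplicialComplex X}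

/-- The convex combination `∑ λ_v v` in `E` of a point of the realisation. -/
def evalPoint (p : Realization K) : E := p.weight.sum fun v r => r • (v : E)

theorem evalPoint_mem (h : IsHullClosed X ε K) (p : Realization K) :
    evalPoint p ∈ openDilation X ε := by
  refine h _ p.support_mem ?_
  refine (convex_convexHull ℝ _).sum_mem (fun v _ => p.nonneg v) p.sum_eq_one fun v hv => ?_
  exact subset_convexHull ℝ _ ⟨v, hv, rfl⟩

/-- The map `𝔖(K) → D_ε^-(X)` which extends the identity of `X` and is affine on each simplex. -/
def affineMap (h : IsHullClosed X ε K) : C(Realization K, openDilation X ε) where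
  toFun p := ⟨evalPoint p, evalPoint_mem h p⟩
  continuous_toFun := by
    refine Continuous.subtype_mk (continuous_realization fun s hs => ?_) _
    have e : ∀ t : stdSimplex ℝ s, evalPoint (Realization.simplex K s hs t) =
        ∑ v : s, t.1 v • ((v : X) : E) := fun t =>
      extendWeight_sum s t.1 (fun v r => r • (v : E)) fun v => zero_smul ℝ _
    simp only [e]
    refine continuous_finsetSum _ fun v _ => Continuous.smul ?_ continuous_const
    exact (continuous_apply v).comp continuous_subtype_val

/-- A point of `X`, as a point of `D_ε^-(X)`. -/
def basePoint {X : Set E} {ε : ℝ} (hε : 0 < ε) (x : X) : openDilation X ε :=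
  ⟨x, subset_openDilation X hε x.2⟩

theorem affineMap_vertex (h : IsHullClosed X ε K) (hε : 0 < ε) (x : X) :
    affineMap h (Realization.vertex K x) = basePoint hε x := by
  refine Subtype.ext ?_
  change (Finsupp.single x (1 : ℝ)).sum (fun v r => r • (v : E)) = x
  rw [Finsupp.sum_single_index (h := fun (v : X) (r : ℝ) => r • (v : E)) (zero_smul ℝ _), one_smul]

/-- The homomorphism `π₁(𝔖(K), x) → π₁(D_ε^-(X), x)` induced by the affine map. -/
def affinePi1 (h : IsHullClosed X ε K) (hε : 0 < ε) (x : X) :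
    FundamentalGroup (Realization K) (Realization.vertex K x) →*
      FundamentalGroup (openDilation X ε) (basePoint hε x) :=
  FundamentalGroup.mapOfEq (affineMap h) (affineMap_vertex h hε x)

end Dilation

/-- The homomorphism `π₁(𝔖(K), x) → π₁(𝔖(L), x)` induced by the inclusion of a subobject
`K ≺ L` on the same vertices. -/
def Realization.inclPi1 {V : Type*} {K L : AbstractSimplicialComplex V} (h : K ≤ L) (x : V) :
    FundamentalGroup (Realization K) (Realization.vertex K x) →*
      FundamentalGroup (Realization L) (Realization.vertex L x) :=
  FundamentalGroup.map (Realization.incl h) (Realization.vertex K x)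

end CombSpace

end

/-! The proof is a one-dimensional nerve argument, run once for a general `GoodCover` and applied
twice. Let a space `Y` have an open cover indexed by the vertices of `K`, such that members with a
common point have linked indices, and let `F : 𝔖(K) → Y` send the first half of each edge into the
member of its first vertex and the second half into that of its second vertex.

A path in `Y` between vertices, sampled at the scale of a Lebesgue number, becomes a combinatorial
path; condition `homotopic` says that the image of the latter is homotopic to the original path.
This gives surjectivity of `[a] ↦ [F ∘ â]` (`exists_loop`). A contraction of `F ∘ â` is labelled in
the same way on a fine grid: the four cells meeting at a corner have linked labels, and the result
is a combinatorial contraction of a slowed-down copy of `a` (`homotopic_const_of_plane`). Slowing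
down does not change the class (`Loop.homotopic_of_reparam`), whence injectivity. The
one-dimensional sampling also settles `π₀`.

The open stars of `𝔖(K)`, with `F` the identity, show that `Φ₁` and `Φ₀` are bijective for every `K`
(`goodCover_star`). The balls of radius `ε/2`, with `F` the affine map, show that the composites
`π₁(f⁻) ∘ Φ₁` and `π₀(f⁻) ∘ Φ₀` are bijective (`goodCover_ball`). Cancelling gives (a).

For `t_ε` the ball cover is not good: the midpoint of an edge of length exactly `ε` is at distance
`ε/2` from both ends. So (b) is deduced from (a). The inclusion `t_ε⁻X ≺ t_εX` is injective on `π₁`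
because it factors the bijective composite of (a). It is surjective because `t_ε`-closedness puts,
between any two `t_ε`-linked points, a third point of `X` at distance less than `ε` from both
(`IsTolClosed.exists_between`). All other arrows follow from the commuting squares. -/

noncomputable section

namespace CombSpace

open scoped unitInterval

/-! ### Criteria for homotopy of paths -/

section Paths

variable {Y : Type*} [TopologicalSpace Y]

theorem homotopic_of_square {y z : Y} {p q : Path y z} (H : I × I → Y) (hH : Continuous H)
    (h0 : ∀ t, H (0, t) = p t) (h1 : ∀ t, H (1, t) = q t) (hl : ∀ s, H (s, 0) = y)
    (hr : ∀ s, H (s, 1) = z) : p.Homotopic q :=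
  ⟨{ toFun := H
     continuous_toFun := hH
     map_zero_left := h0
     map_one_left := h1
     prop' := by
      rintro s t (rfl | ht)
      · exact (hl s).trans p.source.symm
      · rw [Set.mem_singleton_iff] at ht
        subst ht
        exact (hr s).trans p.target.symm }⟩

/-- Two parametrisations of a line which is constant on the left of `m` and on the right of `n`. -/
theorem homotopic_of_line {G : ℝ → Y} (hG : Continuous G) {y z : Y} {m n : ℝ}
    (hm : ∀ t ≤ m, G t = y) (hn : ∀ t, n ≤ t → G t = z) {p q : Path y z} {φ ψ : I → ℝ}
    (hφ : Continuous φ) (hψ : Continuous ψ) (hp : ∀ t, p t = G (φ t)) (hq : ∀ t, q t = G (ψ t))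
    (hφ0 : φ 0 ≤ m) (hψ0 : ψ 0 ≤ m) (hφ1 : n ≤ φ 1) (hψ1 : n ≤ ψ 1) : p.Homotopic q := by
  refine homotopic_of_square (fun s => G ((1 - (s.1 : ℝ)) * φ s.2 + s.1 * ψ s.2)) (by fun_prop)
    (fun t => by simp [hp]) (fun t => by simp [hq]) (fun s => hm _ ?_) (fun s => hn _ ?_)
  · nlinarith [s.2.1, s.2.2]
  · nlinarith [s.2.1, s.2.2]

end Paths

/-! ### The direct limit topology: finite subcomplexes and straight-line homotopies -/

namespace Realization

variable {V : Type*} {K : AbstractSimplicialComplex V}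

open Classical in
theorem simplex_weight (s : Finset V) (hs : s ∈ K) (t : stdSimplex ℝ s) (v : V) :
    (simplex K s hs t).weight v = if h : v ∈ s then t ⟨v, h⟩ else 0 := by
  dsimp only [simplex, extendWeight]
  rw [Finsupp.onFinset_apply]
  rfl

theorem support_simplex_subset (s : Finset V) (hs : s ∈ K) (t : stdSimplex ℝ s) :
    (simplex K s hs t).weight.support ⊆ s := by
  classical
  intro v hv
  by_contra h
  rw [Finsupp.mem_support_iff, simplex_weight, dif_neg h] at hv
  exact hv rfl

theorem simplex_injective (s : Finset V) (hs : s ∈ K) : Function.Injective (simplex K s hs) := by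
  classical
  intro t t' h
  refine Subtype.ext (funext fun v => ?_)
  have := congrArg (fun p : Realization K => p.weight v) h
  simp only [simplex_weight, dif_pos v.2] at this
  exact this

theorem continuous_weight (v : V) : Continuous fun p : Realization K => p.weight v := by
  classical
  refine continuous_realization fun s hs => ?_
  simp only [simplex_weight]
  split_ifs with h
  · exact (continuous_apply _).comp continuous_subtype_val
  · exact continuous_const

theorem sum_eq_of_support_subset (p : Realization K) {s : Finset V}
    (h : p.weight.support ⊆ s) : ∑ v : s, p.weight v = 1 := by
  rw [Finset.sum_coe_sort s p.weight, ← p.sum_eq_one, Finsupp.sum]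
  exact (Finset.sum_subset h fun v _ hv => Finsupp.notMem_support_iff.1 hv).symm

/-- The barycentric coordinates of a point with respect to a linked part containing its support. -/
def coords (p : Realization K) (s : Finset V) (h : p.weight.support ⊆ s) : stdSimplex ℝ s :=
  ⟨fun v => p.weight v, fun v => p.nonneg v, sum_eq_of_support_subset p h⟩

theorem simplex_coords (p : Realization K) (s : Finset V) (hs : s ∈ K)
    (h : p.weight.support ⊆ s) : simplex K s hs (p.coords s h) = p := by
  classical
  refine Realization.ext (Finsupp.ext fun v => ?_)
  rw [simplex_weight]
  split_ifs with hv
  · rfl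
  · exact (Finsupp.notMem_support_iff.1 fun hv' => hv (h hv')).symm

/-- A map to the realisation with values in a finite subcomplex is continuous as soon as its
coordinates are. -/
theorem continuous_of_finite {Z : Type*} [TopologicalSpace Z] {g : Z → Realization K}
    (T : Finset V) (hT : ∀ z, (g z).weight.support ⊆ T)
    (hg : ∀ v, Continuous fun z => (g z).weight v) : Continuous g := by
  classical
  have hfin : Finite {s : Finset V // s ∈ T.powerset ∧ s ∈ K} :=
    Finite.of_injective (fun s => (⟨s.1, s.2.1⟩ : T.powerset))
      fun s t h => Subtype.ext (congrArg (fun x : T.powerset => x.1) h)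
  -- The closed sets where the support lies in a given face of `T` form a finite cover, so
  -- continuity can be checked on each; there `g` factors through a single simplex, where
  -- barycentric coordinates determine the topology.
  refine (locallyFinite_of_finite
    fun s : {s : Finset V // s ∈ T.powerset ∧ s ∈ K} => {z | (g z).weight.support ⊆ s.1}).continuous
    ?_ ?_ ?_
  · exact Set.eq_univ_iff_forall.2 fun z => Set.mem_iUnion.2
      ⟨⟨_, Finset.mem_powerset.2 (hT z), (g z).support_mem⟩, Finset.Subset.refl _⟩
  · intro s
    have : {z | (g z).weight.support ⊆ s.1} = ⋂ v ∈ {v | v ∉ s.1}, {z | (g z).weight v = 0} := by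
      ext z
      simp only [Set.mem_ofPred_eq, Set.mem_iInter, Finset.subset_iff, Finsupp.mem_support_iff]
      exact ⟨fun h v hv => by_contra fun h' => hv (h h'), fun h v hv => by_contra fun h' => hv (h v h')⟩
    rw [this]
    exact isClosed_biInter fun v _ => isClosed_eq (hg v) continuous_const
  · intro s
    rw [continuousOn_iff_continuous_domRestrict]
    have hc : Continuous fun z : {z | (g z).weight.support ⊆ s.1} => (g z).coords s.1 z.2 :=
      Continuous.subtype_mk (continuous_pi fun v : s.1 => (hg v.1).comp continuous_subtype_val) _
    exact ((continuous_simplex s.1 s.2.2).comp hc).congr fun z => simplex_coords _ _ _ _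

/-- A set of points with distinct supports is closed. -/
theorem isClosed_of_injOn_support {A : Set (Realization K)}
    (hA : Set.InjOn (fun p : Realization K => p.weight.support) A) : IsClosed A := by
  rw [isClosed_iSup_iff]
  rintro ⟨s, hs⟩
  rw [isClosed_coinduced]
  -- A simplex has finitely many faces, and each is the support of at most one point of `A`.
  refine Set.Finite.isClosed ?_
  refine Set.Finite.of_injOn (f := fun t => (simplex K s hs t).weight.support)
    (t := (s.powerset : Set (Finset V)))
    (fun t _ => Finset.mem_coe.2 (Finset.mem_powerset.2 (support_simplex_subset s hs t))) ?_
    (Finset.finite_toSet _)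
  intro t ht t' ht' h
  exact simplex_injective s hs (hA ht ht' h)

/-- A compact part of the realisation lies in a finite subcomplex. -/
theorem exists_finite_support {C : Set (Realization K)} (hC : IsCompact C) :
    ∃ T : Finset V, ∀ p ∈ C, p.weight.support ⊆ T := by
  classical
  let f : Realization K → Finset V := fun p => p.weight.support
  -- `D` contains one point of `C` for each support occurring in `C`. All its subsets are closed, so
  -- it is compact and discrete, hence finite: only finitely many supports occur.
  obtain ⟨D, hDC, hD⟩ := (Set.surjOn_image f C).exists_bijOn_subset
  have hcl : ∀ A ⊆ D, IsClosed A := fun A hA => isClosed_of_injOn_support (hD.injOn.mono hA)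
  have hDc : IsCompact D := hC.of_isClosed_subset (hcl D subset_rfl) hDC
  have hdisc : DiscreteTopology D := by
    rw [discreteTopology_iff_forall_isClosed]
    intro A
    have := (hcl (Subtype.val '' A) (by rintro _ ⟨a, -, rfl⟩; exact a.2)).preimage
      (continuous_subtype_val : Continuous (Subtype.val : D → Realization K))
    rwa [Set.preimage_image_eq _ Subtype.val_injective] at this
  have hDf : D.Finite := hDc.finite ⟨hdisc⟩
  have hfin : (f '' C).Finite := by
    rw [← hD.image_eq]
    exact hDf.image f
  refine ⟨hfin.toFinset.sup id, fun p hp => ?_⟩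
  exact Finset.le_sup (f := id) (hfin.mem_toFinset.2 ⟨p, hp, rfl⟩)

open Classical in
/-- The point `(1 - r) p + r q` of a simplex which contains `p` and `q`. -/
def mix (p q : Realization K) (h : p.weight.support ∪ q.weight.support ∈ K) (r : I) :
    Realization K where
  weight := (1 - r : ℝ) • p.weight + (r : ℝ) • q.weight
  nonneg v := by
    rw [Finsupp.add_apply, Finsupp.smul_apply, Finsupp.smul_apply, smul_eq_mul, smul_eq_mul]
    exact add_nonneg (mul_nonneg (sub_nonneg.2 r.2.2) (p.nonneg v)) (mul_nonneg r.2.1 (q.nonneg v))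
  support_mem := by
    refine support_mem_of_subset h (Finsupp.support_add.trans
      (Finset.union_subset_union Finsupp.support_smul Finsupp.support_smul)) ?_
    rw [Finsupp.sum_add_index' (fun _ => rfl) (fun _ _ _ => rfl),
      Finsupp.sum_smul_index (fun _ => rfl), Finsupp.sum_smul_index (fun _ => rfl),
      ← Finsupp.mul_sum, ← Finsupp.mul_sum, p.sum_eq_one, q.sum_eq_one]
    ring
  sum_eq_one := by
    rw [Finsupp.sum_add_index' (fun _ => rfl) (fun _ _ _ => rfl),
      Finsupp.sum_smul_index (fun _ => rfl), Finsupp.sum_smul_index (fun _ => rfl),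
      ← Finsupp.mul_sum, ← Finsupp.mul_sum, p.sum_eq_one, q.sum_eq_one]
    ring

/-- Keeps straight-line homotopies fixed at the end points, where the two paths agree. -/
theorem mix_self (p : Realization K) (r : I) (q : Realization K) (hq : q = p) (h) :
    mix p q h r = p := by
  subst hq
  refine Realization.ext ?_
  change (1 - r : ℝ) • q.weight + (r : ℝ) • q.weight = q.weight
  rw [← add_smul, sub_add_cancel, one_smul]

open Classical in
/-- Two paths are homotopic when they are pointwise contained in common simplices. -/
theorem homotopic_of_carrier {y z : Realization K} {p q : Path y z}
    (h : ∀ t, (p t).weight.support ∪ (q t).weight.support ∈ K) : p.Homotopic q := by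
  -- Both paths stay in finite subcomplexes, so continuity of the straight-line homotopy for the
  -- direct limit topology reduces to continuity of its coordinates.
  obtain ⟨T, hT⟩ := exists_finite_support (isCompact_range p.continuous)
  obtain ⟨T', hT'⟩ := exists_finite_support (isCompact_range q.continuous)
  refine homotopic_of_square (fun s => mix (p s.2) (q s.2) (h s.2) s.1) ?_ ?_ ?_ ?_ ?_
  · refine continuous_of_finite (T ∪ T') (fun s => ?_) (fun v => ?_)
    · exact (Finsupp.support_add.trans
        (Finset.union_subset_union Finsupp.support_smul Finsupp.support_smul)).trans
        (Finset.union_subset_union (hT _ (mem_range_self _)) (hT' _ (mem_range_self _)))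
    · have h1 : Continuous fun s : I × I => (p s.2).weight v :=
        (continuous_weight v).comp (p.continuous.comp continuous_snd)
      have h2 : Continuous fun s : I × I => (q s.2).weight v :=
        (continuous_weight v).comp (q.continuous.comp continuous_snd)
      simp only [mix, Finsupp.add_apply, Finsupp.smul_apply, smul_eq_mul]
      fun_prop
  · intro t
    exact Realization.ext (by simp [mix])
  · intro t
    exact Realization.ext (by simp [mix])
  · intro s
    dsimp only
    rw [mix_self _ _ _ (q.source.trans p.source.symm), p.source]
  · intro s
    dsimp only
    rw [mix_self _ _ _ (q.target.trans p.target.symm), p.target]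

open Classical in
/-- Two points of a common simplex are joined by a segment. -/
theorem joined_of_carrier {p q : Realization K} (h : p.weight.support ∪ q.weight.support ∈ K) :
    Joined p q := by
  refine ⟨⟨⟨mix p q h, ?_⟩, ?_, ?_⟩⟩
  · refine continuous_of_finite (p.weight.support ∪ q.weight.support) (fun s => ?_) (fun v => ?_)
    · exact Finsupp.support_add.trans
        (Finset.union_subset_union Finsupp.support_smul Finsupp.support_smul)
    · simp only [mix, Finsupp.add_apply, Finsupp.smul_apply, smul_eq_mul]
      fun_prop
  · exact Realization.ext (by simp [mix])
  · exact Realization.ext (by simp [mix])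

open Classical in
theorem support_edge_subset (u v : V) (h : ({u, v} : Finset V) ∈ K) (r : ℝ)
    (hr : r ∈ Icc (0 : ℝ) 1) : (edge u v h r hr).weight.support ⊆ {u, v} := by
  refine Finsupp.support_add.trans (Finset.union_subset ?_ ?_)
  · exact Finsupp.support_single_subset.trans (by simp)
  · exact Finsupp.support_single_subset.trans (by simp)

end Realization

/-! ### Reparametrisation of combinatorial loops -/

section Reparametrisation

variable {V : Type*} {K : AbstractSimplicialComplex V} {x : V}

/-- Translation by one is an elementary delay placed where the loop still rests at the base point.
-/
theorem Loop.homotopic_of_translate_nat (c : ℕ) :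
    ∀ a b : Loop K x, (∀ i, b.toFun i = a.toFun (i - c)) → Homotopic b a := by
  induction c with
  | zero =>
    intro a b h
    rw [Loop.ext (a := b) (b := a) fun i => by simp [h]]
    exact Homotopic.refl a
  | succ c ih =>
    intro a b h
    obtain ⟨m, n, -, hm, -⟩ := a.supp
    refine (ih (a.delayed m) b fun i => ?_).trans (a.delayed_homotopic m)
    dsimp only [Loop.delayed, delay]
    rw [h, Nat.cast_succ]
    split_ifs with hi
    · rw [hm _ (by omega), hm _ hi]
    · congr 1
      ring

theorem Loop.homotopic_of_translate (a b : Loop K x) (c : ℤ)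
    (h : ∀ i, b.toFun i = a.toFun (i + c)) : Homotopic b a := by
  rcases le_total c 0 with hc | hc
  · refine Loop.homotopic_of_translate_nat c.natAbs a b fun i => ?_
    rw [h]
    congr 1
    omega
  · refine (Loop.homotopic_of_translate_nat c.natAbs b a fun i => ?_).symm
    rw [h]
    congr 1
    omega

/-- Induction on the number `d` of stationary steps of `f` in `[p, q]`: each of them is an
elementary delay and can be removed; when none is left, `f` is a translation there. -/
theorem Loop.homotopic_of_stationary (d : ℕ) (a : Loop K x) {m n : ℤ}
    (ha : IsSupport x a.toFun m n) :
    ∀ (b : Loop K x) (f : ℤ → ℤ) (p q : ℤ), (∀ i, f (i + 1) = f i ∨ f (i + 1) = f i + 1) →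
      p ≤ q → f p ≤ m → n ≤ f q → q - p = f q - f p + d →
      (∀ i, b.toFun i = a.toFun (f i)) → Homotopic b a := by
  obtain ⟨-, hl, hr⟩ := ha
  induction d with
  | zero =>
    intro b f p q hf hpq hp hq hd hb
    have hmono : Monotone f := monotone_int_of_le_succ fun i => by have := hf i; omega
    -- With `d = 0` this monotone function takes equal values at `p` and `q`, so it is constant in
    -- between.
    have hmono' : Monotone fun i => i - f i := monotone_int_of_le_succ fun i => by
      have := hf i
      omega
    refine Loop.homotopic_of_translate a b (f p - p) fun i => ?_
    rw [hb]
    rcases le_total i p with hi | hi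
    · have := hmono hi
      rw [hl _ (by omega), hl _ (by omega)]
    rcases le_total q i with hi' | hi'
    · have := hmono hi'
      rw [hr _ (by omega), hr _ (by omega)]
    · have h1 := hmono' hi
      have h2 := hmono' hi'
      dsimp only at h1 h2
      congr 1
      omega
  | succ d ih =>
    intro b f p q hf hpq hp hq hd hb
    have hmono : Monotone f := monotone_int_of_le_succ fun i => by have := hf i; omega
    -- If every step in `[p, q]` moved by one, then `f q - f p` would be `q - p`, against `d + 1 >
    -- 0`.
    obtain ⟨k, hpk, hkq, hk⟩ : ∃ k, p ≤ k ∧ k < q ∧ f (k + 1) = f k := by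
      by_contra! hc
      have key : ∀ j, p ≤ j → j ≤ q → f j = f p + (j - p) := by
        intro j hj
        induction j, hj using Int.leInduction with
        | base => intro; ring
        | succ j hj ihj =>
          intro hjq
          have h1 := hc j hj (by omega)
          have h2 := hf j
          have h3 := ihj (by omega)
          omega
      have := key q hpq le_rfl
      push_cast at hd
      omega
    -- `f` with the repeated value at `k + 1` omitted; delaying at `k` restores it.
    let τ : ℤ → ℤ := fun i => if i ≤ k then f i else f (i + 1)
    have hτ : ∀ i, τ (i + 1) = τ i ∨ τ (i + 1) = τ i + 1 := by
      intro i
      have h1 := hf i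
      have h2 := hf (i + 1)
      dsimp only [τ]
      rcases lt_trichotomy i k with h | h | h
      · rw [if_pos (by omega), if_pos (by omega)]
        exact h1
      · subst h
        rw [if_neg (by omega), if_pos (by omega)]
        omega
      · rw [if_neg (by omega), if_neg (by omega)]
        exact h2
    have hτl : ∀ i ≤ p, τ i ≤ m := by
      intro i hi
      dsimp only [τ]
      rw [if_pos (by omega)]
      exact (hmono hi).trans hp
    have hτr : ∀ i, q - 1 ≤ i → n ≤ τ i := by
      intro i hi
      dsimp only [τ]
      split_ifs with h
      · have : i = k := by omega
        subst this
        rw [← hk]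
        exact hq.trans (hmono (by omega))
      · exact hq.trans (hmono (by omega))
    let b' : Loop K x :=
      { toFun := fun i => a.toFun (τ i)
        isMap := a.isMap.comp (isMap_line_line fun i => ⟨τ i, Or.inl rfl, hτ i⟩)
        supp := ⟨p, q - 1, by omega, fun i hi => hl _ (hτl i hi), fun i hi => hr _ (hτr i hi)⟩ }
    have hb' : Homotopic b' a := by
      refine ih b' τ p (q - 1) hτ (by omega) (hτl p le_rfl) (hτr _ le_rfl) ?_ fun i => rfl
      have h1 : τ p = f p := if_pos hpk
      have h2 : τ (q - 1) = f q := by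
        dsimp only [τ]
        split_ifs with h
        · have : q - 1 = k := by omega
          rw [this, ← hk]
          congr 1
          omega
        · congr 1
          omega
      rw [h1, h2]
      push_cast at hd
      omega
    have he : b = b'.delayed k := by
      refine Loop.ext fun i => ?_
      rw [hb]
      dsimp only [Loop.delayed, delay, b', τ]
      rcases lt_trichotomy i (k + 1) with h | h | h
      · rw [if_pos (by omega), if_pos (by omega)]
      · subst h
        have e : (if k + 1 ≤ k then k + 1 else k + 1 - 1) = k := by split_ifs <;> omega
        rw [e, if_pos le_rfl, hk]
      · rw [if_neg (by omega), if_neg (by omega)]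
        congr 2
        ring
    rw [he]
    exact (b'.delayed_homotopic k).trans hb'

/-- Precomposing a loop with a non-decreasing map whose steps are at most one does not change its
class. -/
theorem Loop.homotopic_of_reparam (a b : Loop K x) {m n : ℤ} (ha : IsSupport x a.toFun m n)
    {f : ℤ → ℤ} (hf : ∀ i, f (i + 1) = f i ∨ f (i + 1) = f i + 1) {p q : ℤ} (hpq : p ≤ q)
    (hp : f p ≤ m) (hq : n ≤ f q) (hb : ∀ i, b.toFun i = a.toFun (f i)) : Homotopic b a := by
  have hmono' : Monotone fun i => i - f i := monotone_int_of_le_succ fun i => by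
    have := hf i
    omega
  have h := hmono' hpq
  dsimp only at h
  exact Loop.homotopic_of_stationary ((q - p) - (f q - f p)).toNat a ha b f p q hf hpq hp hq
    (by omega) hb

end Reparametrisation

/-! ### The homomorphism from combinatorial to topological loops -/

section Comparison

variable {V : Type*} {K : AbstractSimplicialComplex V} {x : V}

open Classical in
theorem Realization.edge_self (u : V) (h : ({u, u} : Finset V) ∈ K) (r : ℝ)
    (hr : r ∈ Icc (0 : ℝ) 1) : Realization.edge u u h r hr = Realization.vertex K u := by
  refine Realization.ext ?_
  dsimp only [Realization.edge, Realization.vertex]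
  rw [← Finsupp.single_add, sub_add_cancel]

theorem Realization.edge_congr {u v u' v' : V} (hu : u = u') (hv : v = v') {h h'} {r r' : ℝ}
    (hrr : r = r') {hr hr'} :
    Realization.edge (K := K) u v h r hr = Realization.edge u' v' h' r' hr' := by
  subst hu hv hrr
  rfl

theorem Loop.hat_eq_vertex (a : Loop K x) {t : ℝ} (h0 : a.toFun ⌊t⌋ = x)
    (h1 : a.toFun (⌊t⌋ + 1) = x) : a.hat t = Realization.vertex K x := by
  classical
  have hx : ({x, x} : Finset V) ∈ K := by
    rw [Finset.pair_eq_singleton]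
    exact K.singleton_mem x
  rw [← Realization.edge_self x hx _ ⟨Int.fract_nonneg t, (Int.fract_lt_one t).le⟩]
  exact Realization.edge_congr h0 h1 rfl

theorem Loop.hat_of_le (a : Loop K x) {m : ℤ} (h : ∀ i ≤ m, a.toFun i = x) {t : ℝ} (ht : t ≤ m) :
    a.hat t = Realization.vertex K x := by
  rcases ht.eq_or_lt with rfl | ht
  · rw [Loop.hat_intCast, h m le_rfl]
  · have := Int.floor_lt.2 ht
    exact a.hat_eq_vertex (h _ (by omega)) (h _ (by omega))

theorem Loop.hat_of_ge (a : Loop K x) {n : ℤ} (h : ∀ i, n ≤ i → a.toFun i = x) {t : ℝ}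
    (ht : (n : ℝ) ≤ t) : a.hat t = Realization.vertex K x := by
  have := Int.le_floor.2 ht
  exact a.hat_eq_vertex (h _ (by omega)) (h _ (by omega))

theorem Loop.hat_congr (a b : Loop K x) {t : ℝ} (k : ℤ) (h0 : a.toFun ⌊t⌋ = b.toFun (⌊t⌋ - k))
    (h1 : a.toFun (⌊t⌋ + 1) = b.toFun (⌊t⌋ + 1 - k)) : a.hat t = b.hat (t - k) := by
  refine Realization.edge_congr ?_ ?_ ?_
  · rw [h0, Int.floor_sub_intCast]
  · rw [h1, Int.floor_sub_intCast]
    congr 1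
    ring
  · rw [Int.fract_sub_intCast]

/-- Both paths run along the same line `â`, which rests at the base point outside the smaller window
`[max m m', min n n']`. -/
theorem Loop.toPath_homotopic (a : Loop K x) {m n m' n' : ℤ} (h : IsSupport x a.toFun m n)
    (h' : IsSupport x a.toFun m' n') : (a.toPath m n h).Homotopic (a.toPath m' n' h') := by
  refine homotopic_of_line a.continuous_hat (m := (max m m' : ℤ)) (n := (min n n' : ℤ))
    (fun t => a.hat_of_le fun i hi => ?_) (fun t => a.hat_of_ge fun i hi => ?_)
    (φ := fun t => (m : ℝ) + t * ((n : ℝ) - m)) (ψ := fun t => (m' : ℝ) + t * ((n' : ℝ) - m'))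
    (by fun_prop) (by fun_prop) (fun _ => rfl) (fun _ => rfl) ?_ ?_ ?_ ?_
  · rcases le_max_iff.1 hi with hi | hi
    · exact h.2.1 i hi
    · exact h'.2.1 i hi
  · rcases min_le_iff.1 hi with hi | hi
    · exact h.2.2 i hi
    · exact h'.2.2 i hi
  all_goals simp

open Classical in
theorem Loop.hat_support_subset (a : Loop K x) (t : ℝ) :
    (a.hat t).weight.support ⊆ {a.toFun ⌊t⌋, a.toFun (⌊t⌋ + 1)} :=
  Realization.support_edge_subset _ _ _ _ _

-- Consecutive rows of a double path, read at the same parameter, lie in the simplex of an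
-- elementary square, so `Realization.homotopic_of_carrier` applies row by row.
open Classical in
theorem Homotopic.toPath {a b : Loop K x} (hab : Homotopic a b) {m n m' n' : ℤ}
    (h : IsSupport x a.toFun m n) (h' : IsSupport x b.toFun m' n') :
    (a.toPath m n h).Homotopic (b.toPath m' n' h') := by
  obtain ⟨A, hA, m₁, n₁, p, q, hmn, hpq, h1, h2, h3, h4⟩ := hab
  rw [isMap_plane_iff] at hA
  let R : ℤ → Loop K x := fun j =>
    { toFun := fun i => A (i, j)
      isMap := isMap_line_iff.2 fun i => face_of_subset (hA i j)
        (by intro v hv; simp only [Finset.mem_insert, Finset.mem_singleton] at hv ⊢; tauto)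
        (by simp)
      supp := ⟨m₁, n₁, hmn, fun i hi => h1 i j hi, fun i hi => h2 i j hi⟩ }
  have hR : ∀ j, IsSupport x (R j).toFun m₁ n₁ := fun j =>
    ⟨hmn, fun i hi => h1 i j hi, fun i hi => h2 i j hi⟩
  have hpa : R p = a := Loop.ext fun i => h3 i p le_rfl
  have hqb : R q = b := Loop.ext fun i => h4 i q le_rfl
  have key : ∀ j, p ≤ j → ((R p).toPath m₁ n₁ (hR p)).Homotopic ((R j).toPath m₁ n₁ (hR j)) := by
    intro j hj
    induction j, hj using Int.leInduction with
    | base => exact Path.Homotopic.refl _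
    | succ j hj ih =>
      refine ih.trans (Realization.homotopic_of_carrier fun t => ?_)
      refine face_of_subset (hA ⌊(m₁ : ℝ) + t * ((n₁ : ℝ) - m₁)⌋ j) ?_ ?_
      · refine (Finset.union_subset_union ((R j).hat_support_subset _)
          ((R (j + 1)).hat_support_subset _)).trans ?_
        intro v hv
        simp only [Finset.mem_union, Finset.mem_insert, Finset.mem_singleton] at hv ⊢
        tauto
      · exact ((K.isRelLowerSet_faces (Realization.support_mem _)).1).mono
          Finset.subset_union_left
  -- The extreme rows equal `a` and `b`, but the paths depend on proofs of support; these are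
  -- generalised so that the rows can be rewritten.
  have hk := key q hpq
  generalize_proofs e1 e2 at hk
  revert e1 e2
  rw [hpa, hqb]
  intro e1 e2 hk
  exact ((a.toPath_homotopic h e1).trans hk).trans (b.toPath_homotopic e2 h')

theorem Loop.concat_isSupport (a b : Loop K x) {m n m' n' : ℤ} (ha : IsSupport x a.toFun m n)
    (hb : IsSupport x b.toFun m' n') :
    IsSupport x (a.concat b n m' ha.2.2 hb.2.1).toFun (m + m') (n + n') := by
  obtain ⟨h0, h1, h2⟩ := ha
  obtain ⟨h0', h1', h2'⟩ := hb
  refine ⟨by omega, fun i hi => ?_, fun i hi => ?_⟩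
  · dsimp only [Loop.concat, concatFun]
    rw [if_pos (by omega), h1 _ (by omega)]
  · dsimp only [Loop.concat]
    rw [concatFun_right h2 h1' (by omega), h2' _ (by omega)]

/-- The line of the concatenation is the line of `a` up to the pasting point `n + m'` and that of
`b` after it, so the two sides differ only by parametrisation. -/
theorem Loop.toPath_concat (a b : Loop K x) {m n m' n' : ℤ} (ha : IsSupport x a.toFun m n)
    (hb : IsSupport x b.toFun m' n') :
    ((a.concat b n m' ha.2.2 hb.2.1).toPath (m + m') (n + n') (a.concat_isSupport b ha hb)).Homotopic
      ((a.toPath m n ha).trans (b.toPath m' n' hb)) := by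
  set c := a.concat b n m' ha.2.2 hb.2.1 with hc
  have hs := a.concat_isSupport b ha hb
  have hl : ∀ t : ℝ, t ≤ (n + m' : ℤ) → c.hat t = a.hat (t - m') := by
    intro t ht
    rcases ht.eq_or_lt with rfl | ht
    · rw [Loop.hat_intCast, ← Int.cast_sub, Loop.hat_intCast, hc]
      dsimp only [Loop.concat, concatFun]
      rw [if_pos le_rfl]
    · have := Int.floor_lt.2 ht
      refine Loop.hat_congr c a m' ?_ ?_
      · exact if_pos (by omega)
      · exact if_pos (by omega)
  have hr : ∀ t : ℝ, ((n + m' : ℤ) : ℝ) ≤ t → c.hat t = b.hat (t - n) := by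
    intro t ht
    have := Int.le_floor.2 ht
    refine Loop.hat_congr c b n ?_ ?_
    · exact concatFun_right ha.2.2 hb.2.1 (by omega)
    · exact concatFun_right ha.2.2 hb.2.1 (by omega)
  have h1 : (m : ℝ) ≤ n := by exact_mod_cast ha.1
  have h2 : (m' : ℝ) ≤ n' := by exact_mod_cast hb.1
  refine homotopic_of_line c.continuous_hat (m := (m + m' : ℤ)) (n := (n + n' : ℤ))
    (fun t => c.hat_of_le hs.2.1) (fun t => c.hat_of_ge hs.2.2)
    (φ := fun t => ((m + m' : ℤ) : ℝ) + t * (((n + n' : ℤ) : ℝ) - (m + m' : ℤ)))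
    -- Piecewise linear, reaching the pasting point `n + m'` at `t = 1/2`, where `Path.trans`
    -- switches.
    (ψ := fun t => ((m + m' : ℤ) : ℝ) + ((n : ℝ) - m) * min (2 * (t : ℝ)) 1 +
      ((n' : ℝ) - m') * max (2 * (t : ℝ) - 1) 0)
    (by fun_prop) (by fun_prop) (fun _ => rfl) (fun t => ?_) ?_ ?_ ?_ ?_
  · rw [Path.trans_apply]
    split_ifs with ht
    · rw [min_eq_left (by linarith), max_eq_right (by linarith), hl]
      · change a.hat _ = a.hat _
        congr 1
        push_cast
        ring
      · push_cast
        nlinarith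
    · rw [min_eq_right (by linarith), max_eq_left (by linarith), hr]
      · change b.hat _ = b.hat _
        congr 1
        push_cast
        ring
      · push_cast
        nlinarith
  · simp
  · simp
  · simp
  · norm_num
    linarith

/-- The class of `â`. -/
def Loop.geometric (a : Loop K x) : FundamentalGroup (Realization K) (Realization.vertex K x) :=
  FundamentalGroup.fromPath (Path.Homotopic.Quotient.mk
    (a.toPath a.supp.choose a.supp.choose_spec.choose a.supp.choose_spec.choose_spec))

theorem Loop.geometric_eq (a : Loop K x) {m n : ℤ} (h : IsSupport x a.toFun m n) :
    a.geometric = FundamentalGroup.fromPath (Path.Homotopic.Quotient.mk (a.toPath m n h)) :=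
  Path.Homotopic.Quotient.eq.2 (a.toPath_homotopic _ h)

/-- The map of sets underlying the geometric comparison. -/
def Pi1.geometricFun (g : Pi1 K x) :
    FundamentalGroup (Realization K) (Realization.vertex K x) :=
  Quotient.liftOn g Loop.geometric fun _ _ h =>
    Path.Homotopic.Quotient.eq.2 (Homotopic.toPath h _ _)

/-- The geometric comparison `π₁(K) → π₁(𝔖(K))`, `[a] ↦ [â]`. -/
def Pi1.geometric (K : AbstractSimplicialComplex V) (x : V) :
    Pi1 K x →* FundamentalGroup (Realization K) (Realization.vertex K x) :=
  MonoidHom.mk' Pi1.geometricFun (by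
    rintro ⟨a⟩ ⟨b⟩
    obtain ⟨m, n, ha⟩ := a.supp
    obtain ⟨m', n', hb⟩ := b.supp
    refine (congrArg Pi1.geometricFun (Pi1.mk_mul_mk a b hb.2.2 ha.2.1)).trans ?_
    change Loop.geometric _ = a.geometric * b.geometric
    rw [Loop.geometric_eq _ (b.concat_isSupport a hb ha), a.geometric_eq ha, b.geometric_eq hb,
      FundamentalGroup.mul_def]
    exact Path.Homotopic.Quotient.eq.2 (b.toPath_concat a hb ha))

theorem Pi1.geometric_mk (a : Loop K x) {m n : ℤ} (h : IsSupport x a.toFun m n) :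
    Pi1.geometric K x (Pi1.mk a) =
      FundamentalGroup.fromPath (Path.Homotopic.Quotient.mk (a.toPath m n h)) :=
  a.geometric_eq h

end Comparison

/-! ### Lebesgue numbers and integer division -/

section Mesh

theorem exists_mesh {Y Z V : Type*} [TopologicalSpace Y] [PseudoMetricSpace Z] {C : Set Z}
    (hC : IsCompact C) {H : Z → Y} (hH : Continuous H) {U : V → Set Y} (hU : ∀ v, IsOpen (U v))
    (hcov : ∀ y, ∃ v, y ∈ U v) :
    ∃ k : ℕ, ∀ N : ℕ, k < N → ∀ z ∈ C, ∃ v, ∀ w, dist w z ≤ 1 / N → H w ∈ U v := by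
  obtain ⟨δ, hδ, h⟩ := lebesgue_number_lemma_of_metric hC (c := fun v => H ⁻¹' U v)
    (fun v => (hU v).preimage hH) fun z _ => Set.mem_iUnion.2 (hcov (H z))
  obtain ⟨k, hk⟩ := exists_nat_one_div_lt hδ
  refine ⟨k, fun N hN z hz => ?_⟩
  obtain ⟨v, hv⟩ := h z hz
  refine ⟨v, fun w hw => hv (Metric.mem_ball.2 ((hw.trans ?_).trans_lt hk))⟩
  have : ((k : ℝ) + 1) ≤ N := by exact_mod_cast hN
  exact one_div_le_one_div_of_le (by positivity) this

theorem dist_div_le {t i N : ℝ} (hN : 0 < N) (h : |t - i| ≤ 1) : dist (t / N) (i / N) ≤ 1 / N := by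
  rw [Real.dist_eq, ← sub_div, abs_div, abs_of_pos hN]
  exact div_le_div_of_nonneg_right h hN.le

theorem ediv_eq {N c q : ℤ} (hN : 0 < N) (h0 : N * q ≤ c) (h1 : c < N * (q + 1)) : c / N = q := by
  have e0 : q ≤ c / N := (Int.le_ediv_iff_mul_le hN).2 (by linarith)
  have e1 : c / N < q + 1 := (Int.ediv_lt_iff_lt_mul hN).2 (by linarith)
  omega

theorem ediv_step {N : ℤ} (hN : 0 < N) (c : ℤ) : (c + 1) / N = c / N ∨ (c + 1) / N = c / N + 1 := by
  have h1 : c / N ≤ (c + 1) / N := Int.ediv_le_ediv hN (by omega)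
  have h2 : (c + 1) / N ≤ (c + N) / N := Int.ediv_le_ediv hN (by omega)
  have h3 : (c + N) / N = c / N + 1 := Int.add_ediv_of_dvd_right (dvd_refl N) |>.trans (by
    rw [Int.ediv_self hN.ne'])
  omega

end Mesh

/-! ### Good covers: paths and homotopies followed combinatorially -/

section GoodCover

variable {V : Type*} {Y : Type*} [TopologicalSpace Y]

open Classical in
/-- An open cover `U` of `Y` indexed by the vertices of `K`, such that finitely many members with a
common point are indexed by a linked part, and a map `F : 𝔖(K) → Y` which is compatible with the
cover on the edges and stays close, up to homotopy, to the paths controlled by the cover. -/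
structure GoodCover (K : AbstractSimplicialComplex V) (F : C(Realization K, Y)) (U : V → Set Y) :
    Prop where
  isOpen : ∀ v, IsOpen (U v)
  cover : ∀ y, ∃ v, y ∈ U v
  linked : ∀ s : Finset V, s.Nonempty → ∀ y, (∀ v ∈ s, y ∈ U v) → s ∈ K
  left : ∀ u v h r hr, r ≤ 1 / 2 → F (Realization.edge u v h r hr) ∈ U u
  right : ∀ u v h r hr, 1 / 2 ≤ r → F (Realization.edge u v h r hr) ∈ U v
  homotopic : ∀ {y z : Y} (p q : Path y z),
    (∀ t, ∃ u v h r hr, p t ∈ U u ∧ p t ∈ U v ∧ q t = F (Realization.edge u v h r hr)) →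
      p.Homotopic q
  joined : ∀ v, ∀ y ∈ U v, Joined y (F (Realization.vertex K v))

namespace GoodCover

variable {K : AbstractSimplicialComplex V} {F : C(Realization K, Y)} {U : V → Set Y} {x : V}

theorem vertex_mem (h : GoodCover K F U) (v : V) : F (Realization.vertex K v) ∈ U v := by
  classical
  have hv : ({v, v} : Finset V) ∈ K := by
    rw [Finset.pair_eq_singleton]
    exact K.singleton_mem v
  rw [← Realization.edge_self v hv 0 ⟨le_rfl, zero_le_one⟩]
  exact h.left _ _ _ _ _ (by norm_num)

/-- Every path of `Y` between vertices is followed by a combinatorial one. -/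
theorem exists_line (h : GoodCover K F U) {u w : V}
    (p : Path (F (Realization.vertex K u)) (F (Realization.vertex K w))) :
    ∃ (N : ℕ) (a : ℤ → V), 0 < N ∧ IsMap line K a ∧ (∀ i ≤ -1, a i = u) ∧
      (∀ i, (N : ℤ) + 1 ≤ i → a i = w) ∧
      ∀ (i : ℤ) (t : ℝ), |t - i| ≤ 1 → p.extend (t / N) ∈ U (a i) := by
  classical
  obtain ⟨k, hk⟩ := exists_mesh (isCompact_Icc (a := (0 : ℝ)) (b := 1)) p.continuous_extend
    h.isOpen h.cover
  have hN := hk (k + 1) (Nat.lt_succ_self k)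
  have hN0 : (0 : ℝ) < (k + 1 : ℕ) := by positivity
  set N := k + 1
  -- The label of `i` controls the whole interval of radius one around it. For `i ≤ -1` or `i ≥ N +
  -- 1` the extended path is constant on that interval, so the end vertices can be imposed.
  have key : ∀ i : ℤ, ∃ v, (i ≤ -1 → v = u) ∧ ((N : ℤ) + 1 ≤ i → v = w) ∧
      ∀ t : ℝ, |t - i| ≤ 1 → p.extend (t / N) ∈ U v := by
    intro i
    rcases le_or_gt i (-1) with hi | hi
    · refine ⟨u, fun _ => rfl, fun _ => by omega, fun t ht => ?_⟩
      have : (i : ℝ) ≤ -1 := by exact_mod_cast hi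
      rw [p.extend_of_le_zero (div_nonpos_of_nonpos_of_nonneg
        (by linarith [(abs_le.1 ht).2]) hN0.le)]
      exact h.vertex_mem u
    rcases le_or_gt ((N : ℤ) + 1) i with hi' | hi'
    · refine ⟨w, fun _ => by omega, fun _ => rfl, fun t ht => ?_⟩
      have : (N : ℝ) + 1 ≤ i := by exact_mod_cast hi'
      rw [p.extend_of_one_le ((one_le_div hN0).2 (by linarith [(abs_le.1 ht).1]))]
      exact h.vertex_mem w
    · have h0 : (0 : ℝ) ≤ i := by exact_mod_cast (by omega : 0 ≤ i)
      have h1 : (i : ℝ) ≤ N := by exact_mod_cast (by omega : i ≤ N)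
      obtain ⟨v, hv⟩ := hN ((i : ℝ) / N) ⟨div_nonneg h0 hN0.le, (div_le_one hN0).2 h1⟩
      exact ⟨v, fun _ => by omega, fun _ => by omega, fun t ht => hv _ (dist_div_le hN0 ht)⟩
  choose a ha0 ha1 ha using key
  refine ⟨N, a, Nat.succ_pos k, isMap_line_iff.2 fun i => ?_, ha0, ha1, ha⟩
  -- The sample at `i / N` is controlled by the labels of both `i` and `i + 1`.
  refine h.linked _ (by simp) (p.extend ((i : ℝ) / N)) fun v hv => ?_
  rcases Finset.mem_insert.1 hv with rfl | hv
  · exact ha i _ (by simp)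
  · rw [Finset.mem_singleton.1 hv]
    exact ha (i + 1) _ (by simp)

/-- `q` is `p` run at the speed of `â`. It is homotopic to `p` by reparametrisation, and to the
image of `â` because at each time its value lies in the members of both ends of the edge containing
`â`. -/
theorem exists_loop (h : GoodCover K F U)
    (p : Path (F (Realization.vertex K x)) (F (Realization.vertex K x))) :
    ∃ (a : Loop K x) (m n : ℤ) (ha : IsSupport x a.toFun m n),
      ((a.toPath m n ha).map F.continuous).Homotopic p := by
  obtain ⟨N, a, hN, ha, ha0, ha1, hp⟩ := h.exists_line p
  have hs : IsSupport x a (-1) (N + 1) := ⟨by omega, ha0, ha1⟩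
  let b : Loop K x := ⟨a, ha, _, _, hs⟩
  have hN0 : (0 : ℝ) < N := by exact_mod_cast hN
  let φ : I → ℝ := fun t => ((-1 : ℤ) : ℝ) + t * ((((N : ℤ) + 1 : ℤ) : ℝ) - ((-1 : ℤ) : ℝ))
  have hφ : Continuous φ := by fun_prop
  have hφ0 : φ 0 / N ≤ 0 := by
    simp only [φ, Icc.coe_zero]
    exact div_nonpos_of_nonpos_of_nonneg (by norm_num) hN0.le
  have hφ1 : 1 ≤ φ 1 / N := by
    rw [one_le_div hN0]
    simp only [φ, Icc.coe_one]
    push_cast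
    linarith
  let q : Path (F (Realization.vertex K x)) (F (Realization.vertex K x)) :=
    ⟨⟨fun t => p.extend (φ t / N), p.continuous_extend.comp (hφ.div_const _)⟩,
      p.extend_of_le_zero hφ0, p.extend_of_one_le hφ1⟩
  refine ⟨b, _, _, hs, ?_⟩
  have h1 : q.Homotopic p := homotopic_of_line p.continuous_extend (m := 0) (n := 1)
    (fun t ht => p.extend_of_le_zero ht) (fun t ht => p.extend_of_one_le ht)
    (φ := fun t => φ t / N) (ψ := fun t => (t : ℝ)) (hφ.div_const _) continuous_subtype_val
    (fun _ => rfl) (fun t => (p.extend_apply t.2).symm) hφ0 (by simp) hφ1 (by simp)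
  refine (h.homotopic q _ fun t => ?_).symm.trans h1
  have hf := Int.floor_le (φ t)
  have hf' := Int.lt_floor_add_one (φ t)
  refine ⟨_, _, isMap_line_iff.1 ha ⌊φ t⌋, Int.fract (φ t),
    ⟨Int.fract_nonneg _, (Int.fract_lt_one _).le⟩, hp ⌊φ t⌋ (φ t) ?_, hp (⌊φ t⌋ + 1) (φ t) ?_, rfl⟩
  · rw [abs_le]
    constructor <;> linarith
  · push_cast
    rw [abs_le]
    constructor <;> linarith

/-- Cutting a unit interval into `2k` equal parts puts its midpoint on the grid, so each part lies
in the half controlled by one end. Adding `k` before dividing rounds `i / (2k)` to the index of that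
end. -/
theorem hat_mem (h : GoodCover K F U) (a : Loop K x) {k : ℤ} (hk : 0 < k) (i : ℤ) {t : ℝ}
    (h0 : (i : ℝ) ≤ t * (2 * k : ℤ)) (h1 : t * (2 * k : ℤ) ≤ i + 1) :
    F (a.hat t) ∈ U (a.toFun ((i + k) / (2 * k))) := by
  have hkR : (0 : ℝ) < k := by exact_mod_cast hk
  have e1 := Int.mul_ediv_add_emod i (2 * k)
  have e2 := Int.emod_nonneg i (by omega : 2 * k ≠ 0)
  have e3 := Int.emod_lt_of_pos i (by omega : 0 < 2 * k)
  set e := i / (2 * k)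
  set r := i % (2 * k)
  have hi : (i : ℝ) = 2 * k * e + r := by exact_mod_cast e1.symm
  have hr0 : (0 : ℝ) ≤ r := by exact_mod_cast e2
  have hr1 : (r : ℝ) + 1 ≤ 2 * k := by exact_mod_cast e3
  push_cast at h0 h1
  rw [hi] at h0 h1
  have ht0 : (e : ℝ) ≤ t := by nlinarith
  have ht1 : t ≤ e + 1 := by nlinarith
  have hdiv : (i + k) / (2 * k) = if r < k then e else e + 1 := by
    split_ifs with hr
    · refine ediv_eq (by omega) ?_ ?_ <;> nlinarith
    · refine ediv_eq (by omega) ?_ ?_ <;> nlinarith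
  -- At the right end of the interval the floor has already jumped, so this point is treated as a
  -- vertex; it can only belong to a part of the second half.
  rcases ht1.eq_or_lt with rfl | ht1
  · have hr : ¬ r < k := by
      intro hr
      have : (r : ℝ) + 1 ≤ k := by exact_mod_cast hr
      nlinarith
    rw [hdiv, if_neg hr, show (e : ℝ) + 1 = ((e + 1 : ℤ) : ℝ) by push_cast; rfl, Loop.hat_intCast]
    exact h.vertex_mem _
  · have hfl : ⌊t⌋ = e := Int.floor_eq_iff.2 ⟨ht0, ht1⟩
    have hfr : Int.fract t = t - e := by rw [Int.fract, hfl]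
    rw [hdiv, ← hfl]
    split_ifs with hr
    · have : (r : ℝ) + 1 ≤ k := by exact_mod_cast hr
      refine h.left _ _ _ _ _ ?_
      rw [hfr]
      nlinarith
    · have : (k : ℝ) ≤ r := by exact_mod_cast not_lt.1 hr
      refine h.right _ _ _ _ _ ?_
      rw [hfr]
      nlinarith

/-- A loop which is contracted in the plane by a map to `Y` is combinatorially trivial. -/
theorem homotopic_const_of_plane (h : GoodCover K F U) (a : Loop K x) {m n : ℤ}
    (ha : IsSupport x a.toFun m n) {H : ℝ × ℝ → Y} (hH : Continuous H)
    (hbot : ∀ t s : ℝ, s ≤ 0 → H (t, s) = F (a.hat t))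
    (htop : ∀ t s : ℝ, 1 ≤ s → H (t, s) = F (Realization.vertex K x))
    (hleft : ∀ t s : ℝ, t ≤ m → H (t, s) = F (Realization.vertex K x))
    (hright : ∀ t s : ℝ, (n : ℝ) ≤ t → H (t, s) = F (Realization.vertex K x)) :
    Homotopic a (Loop.const K x) := by
  classical
  obtain ⟨k₀, hk₀⟩ := exists_mesh
    ((isCompact_Icc (a := (m : ℝ)) (b := n)).prod (isCompact_Icc (a := (0 : ℝ)) (b := 1)))
    hH h.isOpen h.cover
  -- An even mesh exceeding `k₀`: fine enough for the cover, and of the form required by `hat_mem`.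
  have hmesh := hk₀ (2 * (k₀ + 1)) (by omega)
  obtain ⟨k, hk⟩ : ∃ k : ℤ, k = (k₀ : ℤ) + 1 := ⟨_, rfl⟩
  have hkpos : 0 < k := by omega
  obtain ⟨N, hN⟩ : ∃ N : ℤ, N = 2 * k := ⟨_, rfl⟩
  have hNpos : 0 < N := by omega
  have hNR : (0 : ℝ) < N := by exact_mod_cast hNpos
  have hNc : ((2 * (k₀ + 1) : ℕ) : ℝ) = N := by
    rw [hN, hk]
    push_cast
    ring
  rw [hNc] at hmesh
  clear hk₀ hNc
  let f : ℤ → ℤ := fun i => (i + k) / N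
  have hstep : ∀ i, f (i + 1) = f i ∨ f (i + 1) = f i + 1 := by
    intro i
    have := ediv_step hNpos (i + k)
    rwa [add_right_comm] at this
  have hmono : Monotone f := fun i j hij => Int.ediv_le_ediv hNpos (by omega)
  have hfN : ∀ c, f (N * c) = c := by
    intro c
    refine ediv_eq (by omega) ?_ ?_ <;> nlinarith
  have hbl : ∀ i ≤ N * m, a.toFun (f i) = x := fun i hi =>
    ha.2.1 _ ((hmono hi).trans (hfN m).le)
  have hbr : ∀ i, N * n ≤ i → a.toFun (f i) = x := fun i hi =>
    ha.2.2 _ ((hfN n).ge.trans (hmono hi))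
  have hmn : N * m ≤ N * n := by nlinarith [ha.1]
  -- `a` slowed down by the factor `N`, with rounding to the nearest integer; this is the bottom row
  -- of the grid.
  let b : Loop K x :=
    { toFun := fun i => a.toFun (f i)
      isMap := a.isMap.comp (isMap_line_line fun i => ⟨f i, Or.inl rfl, hstep i⟩)
      supp := ⟨N * m, N * n, hmn, hbl, hbr⟩ }
  have hba : Homotopic b a := Loop.homotopic_of_reparam a b ha hstep hmn (hfN m).le (hfN n).ge
    fun i => rfl
  refine hba.symm.trans ?_
  -- Each cell `[i, i+1] × [j, j+1]` of the rescaled plane gets a vertex whose member contains its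
  -- image. Below the rectangle the label is prescribed by `b`, and beside or above it by the base
  -- point; inside, the Lebesgue number supplies it.
  have key : ∀ i j : ℤ, ∃ v, (j < 0 → v = a.toFun (f i)) ∧
      (0 ≤ j → (i + 1 ≤ N * m ∨ N * n ≤ i ∨ N ≤ j) → v = x) ∧
      ∀ t s : ℝ, (i : ℝ) ≤ t → t ≤ i + 1 → (j : ℝ) ≤ s → s ≤ j + 1 →
        H (t / N, s / N) ∈ U v := by
    intro i j
    rcases lt_or_ge j 0 with hj | hj
    · refine ⟨_, fun _ => rfl, fun _ => by omega, fun t s ht0 ht1 _ hs => ?_⟩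
      have hj' : (j : ℝ) + 1 ≤ 0 := by exact_mod_cast hj
      rw [hbot _ _ (div_nonpos_of_nonpos_of_nonneg (by linarith) hNR.le)]
      have := h.hat_mem a hkpos i (t := t / N)
      rw [← hN, div_mul_cancel₀ _ hNR.ne'] at this
      exact this ht0 ht1
    by_cases hb : i + 1 ≤ N * m ∨ N * n ≤ i ∨ N ≤ j
    · refine ⟨x, fun _ => by omega, fun _ _ => rfl, fun t s ht0 ht1 hs0 hs1 => ?_⟩
      have : H (t / N, s / N) = F (Realization.vertex K x) := by
        rcases hb with hb | hb | hb
        · have hb' : (i : ℝ) + 1 ≤ N * m := by exact_mod_cast hb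
          refine hleft _ _ ((div_le_iff₀ hNR).2 ?_)
          linarith
        · have hb' : (N : ℝ) * n ≤ i := by exact_mod_cast hb
          refine hright _ _ ((le_div_iff₀ hNR).2 ?_)
          linarith
        · have hb' : (N : ℝ) ≤ j := by exact_mod_cast hb
          exact htop _ _ ((one_le_div hNR).2 (by linarith))
      rw [this]
      exact h.vertex_mem x
    · push Not at hb
      have b1 : (N : ℝ) * m ≤ i := by exact_mod_cast (by omega : N * m ≤ i)
      have b2 : (i : ℝ) ≤ N * n := by exact_mod_cast hb.2.1.le
      have b3 : (j : ℝ) ≤ N := by exact_mod_cast hb.2.2.le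
      have b4 : (0 : ℝ) ≤ j := by exact_mod_cast hj
      obtain ⟨v, hv⟩ := hmesh ((i : ℝ) / N, (j : ℝ) / N)
        ⟨⟨(le_div_iff₀ hNR).2 (by linarith), (div_le_iff₀ hNR).2 (by linarith)⟩,
          ⟨div_nonneg b4 hNR.le, (div_le_one hNR).2 b3⟩⟩
      refine ⟨v, fun _ => by omega, fun _ hb' => by omega, fun t s ht0 ht1 hs0 hs1 => hv _ ?_⟩
      rw [Prod.dist_eq]
      refine max_le (dist_div_le hNR ?_) (dist_div_le hNR ?_)
      · rw [abs_le]
        constructor <;> linarith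
      · rw [abs_le]
        constructor <;> linarith
  choose A hA0 hA1 hA using key
  -- A cell is indexed by its lower left corner, hence the bounds `N * m - 1` and `-1` on the left
  -- and below.
  refine ⟨fun z => A z.1 z.2, isMap_plane_iff.2 fun i j => ?_, N * m - 1, N * n, -1, N, by omega,
    by omega, fun i j hi => ?_, fun i j hi => ?_, fun i j hj => hA0 i j (by omega),
    fun i j hj => hA1 i j (by omega) (by omega)⟩
  · refine h.linked _ (by simp) (H (((i : ℝ) + 1) / N, ((j : ℝ) + 1) / N)) fun v hv => ?_
    simp only [Finset.mem_insert, Finset.mem_singleton] at hv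
    rcases hv with rfl | rfl | rfl | rfl <;> refine hA _ _ _ _ ?_ ?_ ?_ ?_ <;> push_cast <;> linarith
  · dsimp only
    rcases lt_or_ge j 0 with hj | hj
    · rw [hA0 i j hj]
      exact hbl i (by omega)
    · exact hA1 i j hj (by omega)
  · dsimp only
    rcases lt_or_ge j 0 with hj | hj
    · rw [hA0 i j hj]
      exact hbr i hi
    · exact hA1 i j hj (by omega)

theorem homotopic_const (h : GoodCover K F U) (a : Loop K x) {m n : ℤ}
    (ha : IsSupport x a.toFun m n)
    (hH : ((a.toPath m n ha).map F.continuous).Homotopic (Path.refl _)) :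
    Homotopic a (Loop.const K x) := by
  -- The support is enlarged to have positive length, since rescaling to the unit interval divides
  -- by it.
  have ha' : IsSupport x a.toFun m (n + 1) :=
    ⟨by have := ha.1; omega, ha.2.1, fun i hi => ha.2.2 i (by omega)⟩
  obtain ⟨H⟩ := ((a.toPath_homotopic ha' ha).map F).trans hH
  have hmn : (0 : ℝ) < ((n + 1 : ℤ) : ℝ) - m := by
    have : (m : ℝ) ≤ n := by exact_mod_cast ha.1
    push_cast
    linarith
  -- The homotopy on the square is extended to the plane by clamping both coordinates.
  refine h.homotopic_const_of_plane a ha'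
    (H := fun z => H (projIcc 0 1 zero_le_one z.2,
      projIcc 0 1 zero_le_one ((z.1 - m) / (((n + 1 : ℤ) : ℝ) - m)))) ?_ ?_ ?_ ?_ ?_
  · refine H.continuous.comp (Continuous.prodMk ?_ ?_)
    · exact continuous_projIcc.comp continuous_snd
    · exact continuous_projIcc.comp (by fun_prop)
  · intro t s hs
    dsimp only
    rw [projIcc_of_le_left _ hs]
    refine (H.apply_zero _).trans ?_
    change F (a.hat _) = F (a.hat t)
    congr 1
    rcases le_total t m with ht | ht
    · rw [projIcc_of_le_left _ (div_nonpos_of_nonpos_of_nonneg (by linarith) hmn.le),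
        a.hat_of_le ha'.2.1 ht]
      exact a.hat_of_le ha'.2.1 (by simp)
    rcases le_total ((n + 1 : ℤ) : ℝ) t with ht' | ht'
    · rw [projIcc_of_right_le _ ((one_le_div hmn).2 (by linarith)), a.hat_of_ge ha'.2.2 ht']
      exact a.hat_of_ge ha'.2.2 (by simp)
    · rw [projIcc_of_mem _ ⟨div_nonneg (by linarith) hmn.le, (div_le_one hmn).2 (by linarith)⟩]
      congr 1
      field_simp
      ring
  · intro t s hs
    dsimp only
    rw [projIcc_of_right_le _ hs]
    exact H.apply_one _
  · intro t s ht
    dsimp only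
    rw [projIcc_of_le_left _ (div_nonpos_of_nonpos_of_nonneg (by linarith) hmn.le)]
    exact H.source _
  · intro t s ht
    dsimp only
    rw [projIcc_of_right_le _ ((one_le_div hmn).2 (by linarith))]
    exact H.target _

theorem bijective_pi1 (h : GoodCover K F U) {y : Y} (hy : F (Realization.vertex K x) = y) :
    Function.Bijective ((FundamentalGroup.mapOfEq F hy).comp (Pi1.geometric K x)) := by
  subst hy
  have key : ∀ (a : Loop K x) (m n : ℤ) (ha : IsSupport x a.toFun m n),
      (FundamentalGroup.mapOfEq F rfl).comp (Pi1.geometric K x) (Pi1.mk a) =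
        FundamentalGroup.fromPath
          (Path.Homotopic.Quotient.mk ((a.toPath m n ha).map F.continuous)) := by
    intro a m n ha
    rw [MonoidHom.comp_apply, Pi1.geometric_mk a ha, FundamentalGroup.mapOfEq_apply]
    rfl
  constructor
  · rw [injective_iff_map_eq_one]
    rintro ⟨a⟩ hg
    obtain ⟨m, n, ha⟩ := a.supp
    have h1 := (key a m n ha).symm.trans hg
    exact Pi1.sound (h.homotopic_const a ha (Path.Homotopic.Quotient.exact h1))
  · intro g
    obtain ⟨p, rfl⟩ := Path.Homotopic.Quotient.mk_surjective g
    obtain ⟨a, m, n, ha, hp⟩ := h.exists_loop p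
    exact ⟨Pi1.mk a, (key a m n ha).trans (Path.Homotopic.Quotient.eq.2 hp)⟩

end GoodCover

open Classical in
theorem Realization.joined_vertex {K : AbstractSimplicialComplex V} {u v : V}
    (h : ({u, v} : Finset V) ∈ K) : Joined (vertex K u) (vertex K v) := by
  refine joined_of_carrier (face_of_subset h ?_ ?_)
  · exact (Finset.union_subset_union Finsupp.support_single_subset
      Finsupp.support_single_subset).trans (by rw [Finset.insert_eq])
  · exact ((K.isRelLowerSet_faces (vertex K u).support_mem).1).mono Finset.subset_union_left

/-- The geometric comparison `π₀(K) → π₀(𝔖(K))`. -/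
def Pi0.geometric (K : AbstractSimplicialComplex V) : Pi0 K → ZerothHomotopy (Realization K) :=
  Quot.lift (fun v => ZerothHomotopy.mk (Realization.vertex K v)) fun _ _ h =>
    ZerothHomotopy.sound (Realization.joined_vertex h).somePath

/-- Injectivity follows a path by a chain of linked vertices; surjectivity joins a point to the
vertex of a member containing it. -/
theorem GoodCover.bijective_pi0 {K : AbstractSimplicialComplex V} {F : C(Realization K, Y)}
    {U : V → Set Y} (h : GoodCover K F U) :
    Function.Bijective (pi0Map F ∘ Pi0.geometric K) := by
  constructor
  · rintro ⟨u⟩ ⟨w⟩ huw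
    obtain ⟨p⟩ : Joined (F (Realization.vertex K u)) (F (Realization.vertex K w)) :=
      Quotient.exact huw
    obtain ⟨N, a, hN, ha, ha0, ha1, -⟩ := h.exists_line p
    have key : ∀ j : ℤ, -1 ≤ j → Pi0.mk K (a (-1)) = Pi0.mk K (a j) := by
      intro j hj
      induction j, hj using Int.leInduction with
      | base => rfl
      | succ j hj ih => exact ih.trans (Quot.sound (isMap_line_iff.1 ha j))
    have := key (N + 1) (by omega)
    rwa [ha0 _ le_rfl, ha1 _ le_rfl] at this
  · intro c
    obtain ⟨y, rfl⟩ : ∃ y, ZerothHomotopy.mk y = c := Quotient.exists_rep c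
    obtain ⟨v, hv⟩ := h.cover y
    exact ⟨Pi0.mk K v, Quotient.sound (h.joined v y hv).symm⟩

end GoodCover

/-! ### Open stars: the comparison with the realisation -/

section Stars

theorem mapOfEq_id {Y : Type*} [TopologicalSpace Y] {y : Y} (hy : ContinuousMap.id Y y = y)
    (g : FundamentalGroup Y y) : FundamentalGroup.mapOfEq (ContinuousMap.id Y) hy g = g := by
  obtain ⟨p, rfl⟩ := Path.Homotopic.Quotient.mk_surjective g
  rw [FundamentalGroup.mapOfEq_apply]
  rfl

variable {V : Type*} (K : AbstractSimplicialComplex V)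

/-- The open stars of the vertices. -/
theorem goodCover_star :
    GoodCover K (ContinuousMap.id (Realization K)) fun v => {p | 0 < p.weight v} where
  isOpen v := isOpen_lt continuous_const (Realization.continuous_weight v)
  cover p := by
    obtain ⟨v, hv⟩ := (K.isRelLowerSet_faces p.support_mem).1
    exact ⟨v, (p.nonneg v).lt_of_ne (Finsupp.mem_support_iff.1 hv).symm⟩
  linked s hs p hp :=
    face_of_subset p.support_mem (fun v hv => Finsupp.mem_support_iff.2 (hp v hv).ne') hs
  left u v h r hr hr2 := by
    classical
    change 0 < (Finsupp.single u (1 - r) + Finsupp.single v r) u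
    have := hr.1
    rw [Finsupp.add_apply, Finsupp.single_eq_same, Finsupp.single_apply]
    split_ifs <;> linarith
  right u v h r hr hr2 := by
    classical
    change 0 < (Finsupp.single u (1 - r) + Finsupp.single v r) v
    have := hr.2
    rw [Finsupp.add_apply, Finsupp.single_eq_same, Finsupp.single_apply]
    split_ifs <;> linarith
  homotopic p q H := by
    classical
    refine Realization.homotopic_of_carrier fun t => ?_
    obtain ⟨u, v, h, r, hr, hu, hv, hq⟩ := H t
    rw [Finset.union_eq_left.2]
    · exact (p t).support_mem
    · rw [hq]
      refine (Realization.support_edge_subset u v h r hr).trans ?_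
      rw [Finset.insert_subset_iff, Finset.singleton_subset_iff]
      exact ⟨Finsupp.mem_support_iff.2 hu.ne', Finsupp.mem_support_iff.2 hv.ne'⟩
  joined v p hp := by
    classical
    refine Realization.joined_of_carrier ?_
    rw [Finset.union_eq_left.2]
    · exact p.support_mem
    · exact Finsupp.support_single_subset.trans
        (Finset.singleton_subset_iff.2 (Finsupp.mem_support_iff.2 hp.ne'))

/-- The combinatorial fundamental group is the fundamental group of the geometric realisation. -/
theorem Pi1.bijective_geometric (x : V) : Function.Bijective (Pi1.geometric K x) := by
  have h := (goodCover_star K).bijective_pi1 (x := x) (ContinuousMap.id_apply _)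
  convert h using 1
  funext g
  exact (mapOfEq_id (ContinuousMap.id_apply _) _).symm

theorem Pi0.bijective_geometric : Function.Bijective (Pi0.geometric K) := by
  have h := (goodCover_star K).bijective_pi0
  convert h using 1
  funext c
  induction c using Quot.ind
  rfl

end Stars

/-! ### Naturality of the comparison -/

section Inclusion

variable {V : Type*} {K L : AbstractSimplicialComplex V} (h : K ≤ L)

theorem Pi1.geometric_incl (x : V) (g : Pi1 K x) :
    Pi1.geometric L x (Pi1.incl h x g) = Realization.inclPi1 h x (Pi1.geometric K x g) := by
  obtain ⟨a, rfl⟩ : ∃ a, Pi1.mk a = g := Quotient.exists_rep g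
  obtain ⟨m, n, ha⟩ := a.supp
  rw [Pi1.geometric_mk a ha]
  exact Pi1.geometric_mk (a.incl h) ha

theorem Pi0.geometric_incl (c : Pi0 K) :
    Pi0.geometric L (Pi0.incl h c) = pi0Map (Realization.incl h) (Pi0.geometric K c) := by
  induction c using Quot.ind
  rfl

end Inclusion

/-! ### Linked parts of the tolerance structures -/

section Tolerance

theorem mem_openTol_iff {X : Type*} [MetricSpace X] {ε : ℝ} {hε : 0 < ε} {s : Finset X} :
    s ∈ openTol X ε hε ↔ s.Nonempty ∧ ∀ x ∈ s, ∀ y ∈ s, dist x y < ε :=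
  Iff.rfl

theorem mem_tol_iff {X : Type*} [MetricSpace X] {ε : ℝ} {hε : 0 < ε} {s : Finset X} :
    s ∈ tol X ε hε ↔ s.Nonempty ∧ ∀ x ∈ s, ∀ y ∈ s, dist x y ≤ ε :=
  Iff.rfl

theorem isMap_line_openTol {X : Type*} [MetricSpace X] {ε : ℝ} {hε : 0 < ε} {a : ℤ → X}
    (h : ∀ i, dist (a i) (a (i + 1)) < ε) :
    IsMap line (openTol X ε hε) a := by
  classical
  refine isMap_line_iff.2 fun i => mem_openTol_iff.2 ⟨by simp, fun u hu v hv => ?_⟩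
  simp only [Finset.mem_insert, Finset.mem_singleton] at hu hv
  rcases hu with rfl | rfl <;> rcases hv with rfl | rfl <;>
    first | exact h i | (rw [dist_comm]; exact h i) | (rw [dist_self]; exact hε)

end Tolerance

/-! ### Balls of radius `ε/2`: the comparison with the dilation -/

section Dilation

variable {E : Type*} [NormedAddCommGroup E] [NormedSpace ℝ E] {X : Set E} {ε : ℝ}
  {K L : AbstractSimplicialComplex X}

theorem evalPoint_edge (u v : X) (h) (r : ℝ) (hr) :
    evalPoint (Realization.edge (K := K) u v h r hr) = (1 - r) • (u : E) + r • (v : E) := by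
  classical
  rw [evalPoint, Realization.edge,
    Finsupp.sum_add_index' (h := fun (v : X) (r : ℝ) => r • (v : E)) (fun _ => zero_smul ℝ _)
    (fun _ _ _ => add_smul _ _ _), Finsupp.sum_single_index (h := fun (v : X) (r : ℝ) => r • (v : E))
    (zero_smul ℝ _), Finsupp.sum_single_index (h := fun (v : X) (r : ℝ) => r • (v : E))
    (zero_smul ℝ _)]

theorem mix_mem_openDilation (x : X) {y z : E} (hy : dist (x : E) y < ε / 2)
    (hz : dist (x : E) z < ε / 2) (r : I) : (1 - r : ℝ) • y + (r : ℝ) • z ∈ openDilation X ε := by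
  refine ⟨x, x.2, ?_⟩
  rw [← Metric.mem_ball'] at hy hz ⊢
  exact convex_ball _ _ hy hz (sub_nonneg.2 r.2.2) r.2.1 (sub_add_cancel _ _)

/-- The distance is `r * d(u, v)`; the strict bound `d(u, v) < ε` makes it less than `ε/2` even at
the midpoint. -/
theorem dist_evalPoint_left {hε : 0 < ε} {u v : X} (h) {r : ℝ} (hr) (hr2 : r ≤ 1 / 2) :
    dist (u : E) (evalPoint (Realization.edge (K := openTol X ε hε) u v h r hr)) < ε / 2 := by
  have huv : dist (u : E) v < ε := (mem_openTol_iff.1 h).2 u (by simp) v (by simp)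
  rw [evalPoint_edge, dist_eq_norm,
    show (u : E) - ((1 - r) • (u : E) + r • (v : E)) = r • ((u : E) - v) by module,
    norm_smul, Real.norm_of_nonneg hr.1, ← dist_eq_norm]
  nlinarith [dist_nonneg (x := (u : E)) (y := v)]

theorem dist_evalPoint_right {hε : 0 < ε} {u v : X} (h) {r : ℝ} (hr) (hr2 : 1 / 2 ≤ r) :
    dist (v : E) (evalPoint (Realization.edge (K := openTol X ε hε) u v h r hr)) < ε / 2 := by
  have huv : dist (u : E) v < ε := (mem_openTol_iff.1 h).2 u (by simp) v (by simp)
  rw [evalPoint_edge, dist_comm, dist_eq_norm,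
    show ((1 - r) • (u : E) + r • (v : E)) - v = (1 - r) • ((u : E) - v) by module,
    norm_smul, Real.norm_of_nonneg (sub_nonneg.2 hr.2), ← dist_eq_norm]
  nlinarith [dist_nonneg (x := (u : E)) (y := v)]

/-- The open balls of radius `ε/2` centred in `X`. -/
theorem goodCover_ball {hε : 0 < ε} (h : IsOpenTolClosed X ε hε) :
    GoodCover (openTol X ε hε) (affineMap h)
      fun v => {y : openDilation X ε | dist (v : E) y < ε / 2} where
  isOpen v := isOpen_lt (by fun_prop) continuous_const
  cover y := by
    obtain ⟨x, hx, hy⟩ := y.2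
    exact ⟨⟨x, hx⟩, hy⟩
  linked s hs y hy := by
    refine ⟨hs, fun u hu v hv => ?_⟩
    have h1 := hy u hu
    have h2 := hy v hv
    rw [Set.mem_ofPred_eq] at h1 h2
    have h3 := dist_triangle_right (u : E) v y
    change dist (u : E) v < ε
    linarith
  left _ _ he _ hr hr2 := dist_evalPoint_left he hr hr2
  right _ _ he _ hr hr2 := dist_evalPoint_right he hr hr2
  homotopic {y z} p q H := by
    -- The point `p t` lies in the balls of both ends of the edge, and `q t` in that of the nearer
    -- end. The segment between them stays in this ball by convexity; its centre need not vary
    -- continuously with `t`.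
    have key : ∀ t, ∃ x : X, dist (x : E) (p t) < ε / 2 ∧ dist (x : E) (q t) < ε / 2 := by
      intro t
      obtain ⟨u, v, he, r, hr, hu, hv, hq⟩ := H t
      rw [hq]
      rcases le_total r (1 / 2) with hr2 | hr2
      · exact ⟨u, hu, dist_evalPoint_left he hr hr2⟩
      · exact ⟨v, hv, dist_evalPoint_right he hr hr2⟩
    choose c hc hc' using key
    refine homotopic_of_square (fun s => ⟨(1 - s.1 : ℝ) • (p s.2 : E) + (s.1 : ℝ) • (q s.2 : E),
      mix_mem_openDilation (c s.2) (hc s.2) (hc' s.2) s.1⟩) ?_ ?_ ?_ ?_ ?_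
    · exact Continuous.subtype_mk (by fun_prop) _
    · exact fun t => Subtype.ext (by simp)
    · exact fun t => Subtype.ext (by simp)
    · intro s
      refine Subtype.ext ?_
      simp only [p.source, q.source]
      module
    · intro s
      refine Subtype.ext ?_
      simp only [p.target, q.target]
      module
  joined v y hy := by
    rw [affineMap_vertex h hε]
    have hv : dist (v : E) (basePoint hε v : openDilation X ε) < ε / 2 := by
      change dist (v : E) v < ε / 2
      rw [dist_self]
      exact half_pos hε
    refine ⟨⟨⟨fun r => ⟨_, mix_mem_openDilation v hy hv r⟩, ?_⟩, ?_, ?_⟩⟩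
    · exact Continuous.subtype_mk (by fun_prop) _
    · exact Subtype.ext (by simp)
    · exact Subtype.ext (by simp)

theorem affinePi1_inclPi1 (hK : IsHullClosed X ε K) (hL : IsHullClosed X ε L) (hε : 0 < ε)
    (h : K ≤ L) (x : X) (g : FundamentalGroup (Realization K) (Realization.vertex K x)) :
    affinePi1 hL hε x (Realization.inclPi1 h x g) = affinePi1 hK hε x g := by
  obtain ⟨p, rfl⟩ := Path.Homotopic.Quotient.mk_surjective g
  rw [affinePi1, affinePi1, FundamentalGroup.mapOfEq_apply, FundamentalGroup.mapOfEq_apply]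
  rfl

theorem pi0Map_affineMap_incl (hK : IsHullClosed X ε K) (hL : IsHullClosed X ε L)
    (h : K ≤ L) (c : ZerothHomotopy (Realization K)) :
    pi0Map (affineMap hL) (pi0Map (Realization.incl h) c) = pi0Map (affineMap hK) c := by
  obtain ⟨y, rfl⟩ : ∃ y, ZerothHomotopy.mk y = c := Quotient.exists_rep c
  rfl

/-- The ball cover makes the composite with `Φ₁` bijective, the star cover makes `Φ₁` bijective, and
cancellation leaves the affine map. -/
theorem IsOpenTolClosed.bijective_affinePi1 {hε : 0 < ε} (h : IsOpenTolClosed X ε hε) (x : X) :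
    Function.Bijective (affinePi1 h hε x) :=
  (Function.Bijective.of_comp_iff _ (Pi1.bijective_geometric _ x)).1
    ((goodCover_ball h).bijective_pi1 (affineMap_vertex h hε x))

theorem IsOpenTolClosed.bijective_pi0Map {hε : 0 < ε} (h : IsOpenTolClosed X ε hε) :
    Function.Bijective (pi0Map (affineMap h)) :=
  (Function.Bijective.of_comp_iff _ (Pi0.bijective_geometric _)).1 (goodCover_ball h).bijective_pi0

/-! ### From strict to non-strict tolerance -/

/-- Two points at distance at most `ε` are both at distance less than `ε` from a third one. -/
theorem IsTolClosed.exists_between {hε : 0 < ε} (h : IsTolClosed X ε hε) {x y : X}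
    (hxy : dist x y ≤ ε) : ∃ z : X, dist x z < ε ∧ dist z y < ε ∧ (x = y → z = x) := by
  classical
  -- Coincident points get themselves as intermediate point, so that a loop refined by intermediate
  -- points remains constant at both ends.
  by_cases he : x = y
  · subst he
    exact ⟨x, by simpa, by simpa, fun _ => rfl⟩
  have hs : ({x, y} : Finset X) ∈ tol X ε hε := by
    refine mem_tol_iff.2 ⟨by simp, fun u hu v hv => ?_⟩
    simp only [Finset.mem_insert, Finset.mem_singleton] at hu hv
    rcases hu with rfl | rfl <;> rcases hv with rfl | rfl <;>
      first | exact hxy | (rw [dist_comm]; exact hxy) | (rw [dist_self]; exact hε.le)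
  -- The midpoint is within `ε/2` of both points and, by closedness, strictly within `ε/2` of some
  -- `z` in `X`.
  have hm : midpoint ℝ (x : E) y ∈
      convexHull ℝ ((fun v : X => (v : E)) '' (({x, y} : Finset X) : Set X)) :=
    segment_subset_convexHull (Set.mem_image_of_mem _ (by simp)) (Set.mem_image_of_mem _ (by simp))
      (midpoint_mem_segment _ _)
  obtain ⟨z, hz, hd⟩ := h _ hs hm
  rw [Subtype.dist_eq] at hxy
  refine ⟨⟨z, hz⟩, ?_, ?_, fun h => absurd h he⟩ <;> rw [Subtype.dist_eq]
  · have h1 := dist_triangle_right (x : E) z (midpoint ℝ (x : E) y)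
    rw [dist_left_midpoint, Real.norm_ofNat] at h1
    dsimp only
    linarith
  · have h1 := dist_triangle_right z (y : E) (midpoint ℝ (x : E) y)
    rw [dist_right_midpoint, Real.norm_ofNat] at h1
    dsimp only
    linarith

/-- Inserting an intermediate point in every step of a `t_ε`-loop yields a `t_ε⁻`-loop. In `t_εX` it
is homotopic to the original loop run at half speed, because an intermediate point is linked with
the two points it separates. -/
theorem IsTolClosed.surjective_pi1Incl {hε : 0 < ε} (h : IsTolClosed X ε hε) (x : X) :
    Function.Surjective (Pi1.incl (openTol_le_tol X ε hε) x) := by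
  classical
  intro g
  obtain ⟨a, rfl⟩ : ∃ a, Pi1.mk a = g := Quotient.exists_rep g
  obtain ⟨m, n, ha⟩ := a.supp
  have hd : ∀ i, dist (a.toFun i) (a.toFun (i + 1)) ≤ ε := fun i =>
    (mem_tol_iff.1 (isMap_line_iff.1 a.isMap i)).2 _ (by simp) _ (by simp)
  choose z hz hz' hze using fun i => h.exists_between (hd i)
  let b : ℤ → X := fun i => if i % 2 = 0 then a.toFun (i / 2) else z (i / 2)
  have b0 : ∀ j, b (2 * j) = a.toFun j := fun j => by
    dsimp only [b]
    rw [if_pos (by omega)]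
    congr 1
    omega
  have b1 : ∀ j, b (2 * j + 1) = z j := fun j => by
    dsimp only [b]
    rw [if_neg (by omega)]
    congr 1
    omega
  have b2 : ∀ j, b (2 * j + 1 + 1) = a.toFun (j + 1) := fun j => by
    rw [← b0]
    congr 1
    ring
  have hcases : ∀ i : ℤ, ∃ j, i = 2 * j ∨ i = 2 * j + 1 := fun i => ⟨i / 2, by omega⟩
  -- On the left the last odd index below `2 * m` belongs to the step from `m - 1` to `m`, both at
  -- the base point, so its intermediate point is the base point too.
  have hbs : IsSupport x b (2 * m - 1) (2 * n) := by
    refine ⟨by have := ha.1; omega, fun i hi => ?_, fun i hi => ?_⟩ <;>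
      obtain ⟨j, rfl | rfl⟩ := hcases i
    · rw [b0, ha.2.1 _ (by omega)]
    · have h0 := ha.2.1 j (by omega)
      rw [b1, hze j (h0.trans (ha.2.1 (j + 1) (by omega)).symm), h0]
    · rw [b0, ha.2.2 _ (by omega)]
    · have h0 := ha.2.2 j (by omega)
      rw [b1, hze j (h0.trans (ha.2.2 (j + 1) (by omega)).symm), h0]
  have hb : IsMap line (openTol X ε hε) b := by
    refine isMap_line_openTol fun i => ?_
    obtain ⟨j, rfl | rfl⟩ := hcases i
    · rw [b0, b1]
      exact hz j
    · rw [b1, b2]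
      exact hz' j
  let B : Loop (openTol X ε hε) x := ⟨b, hb, _, _, hbs⟩
  have hstep : ∀ i : ℤ, (i + 1) / 2 = i / 2 ∨ (i + 1) / 2 = i / 2 + 1 := fun i => by omega
  let c : Loop (tol X ε hε) x :=
    { toFun := fun i => a.toFun (i / 2)
      isMap := a.isMap.comp (isMap_line_line fun i => ⟨i / 2, Or.inl rfl, hstep i⟩)
      supp := ⟨2 * m, 2 * n, by have := ha.1; omega, fun i hi => ha.2.1 _ (by omega),
        fun i hi => ha.2.2 _ (by omega)⟩ }
  have hca : Homotopic c a := Loop.homotopic_of_reparam a c ha hstep (p := 2 * m) (q := 2 * n)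
    (by have := ha.1; omega) (by omega) (by omega) fun _ => rfl
  refine ⟨Pi1.mk B, (Pi1.sound (?_ : Homotopic (B.incl _) c)).trans (Pi1.sound hca)⟩
  -- A homotopy in one step: each elementary square takes its values in a triple consisting of two
  -- consecutive points of `a` and their intermediate point, which is linked in `t_εX`.
  refine ⟨fun w => if w.2 ≤ 0 then b w.1 else a.toFun (w.1 / 2), isMap_plane_iff.2 fun i j => ?_,
    2 * m - 1, 2 * n, 0, 1, by have := ha.1; omega, by omega, fun i j hi => ?_, fun i j hi => ?_,
    fun i j hj => if_pos hj, fun i j hj => if_neg (by dsimp only; omega)⟩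
  · obtain ⟨l, hl⟩ : ∃ l, ({b i, b (i + 1), a.toFun (i / 2), a.toFun ((i + 1) / 2)} : Finset X) ⊆
        {a.toFun l, z l, a.toFun (l + 1)} := by
      obtain ⟨l, rfl | rfl⟩ := hcases i <;> refine ⟨l, fun v hv => ?_⟩
      · rw [b0, b1, show 2 * l / 2 = l by omega, show (2 * l + 1) / 2 = l by omega] at hv
        simp only [Finset.mem_insert, Finset.mem_singleton] at hv ⊢
        tauto
      · rw [b1, b2, show (2 * l + 1) / 2 = l by omega,
          show (2 * l + 1 + 1) / 2 = l + 1 by omega] at hv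
        simp only [Finset.mem_insert, Finset.mem_singleton] at hv ⊢
        tauto
    have hface : ({a.toFun l, z l, a.toFun (l + 1)} : Finset X) ∈ tol X ε hε := by
      refine mem_tol_iff.2 ⟨by simp, fun u hu v hv => ?_⟩
      have h1 := (hz l).le
      have h2 := (hz' l).le
      have h3 := hd l
      simp only [Finset.mem_insert, Finset.mem_singleton] at hu hv
      rcases hu with rfl | rfl | rfl <;> rcases hv with rfl | rfl | rfl <;>
        first | assumption | (rw [dist_comm]; assumption) | (rw [dist_self]; exact hε.le)
    refine face_of_subset hface (fun v hv => hl ?_) (by simp)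
    simp only [Finset.mem_insert, Finset.mem_singleton] at hv ⊢
    split_ifs at hv <;> tauto
  · dsimp only
    split_ifs
    · exact hbs.2.1 i hi
    · exact ha.2.1 _ (by omega)
  · dsimp only
    split_ifs
    · exact hbs.2.2 i hi
    · exact ha.2.2 _ (by omega)

/-- Injectivity: followed by the lower row of the diagram, the inclusion gives the upper row,
already known to be bijective. -/
theorem IsTolClosed.bijective_pi1Incl {hε : 0 < ε} (h : IsTolClosed X ε hε) (x : X) :
    Function.Bijective (Pi1.incl (openTol_le_tol X ε hε) x) := by
  refine ⟨Function.Injective.of_comp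
    (f := fun g => affinePi1 h hε x (Pi1.geometric _ x g)) ?_, h.surjective_pi1Incl x⟩
  convert ((h.isOpenTolClosed.bijective_affinePi1 x).comp (Pi1.bijective_geometric _ x)).1 using 1
  funext g
  dsimp only [Function.comp]
  rw [Pi1.geometric_incl, affinePi1_inclPi1 h.isOpenTolClosed h]

/-- Surjectivity is immediate, the vertices being the same; injectivity again comes from the upper
row. -/
theorem IsTolClosed.bijective_pi0Incl {hε : 0 < ε} (h : IsTolClosed X ε hε) :
    Function.Bijective (Pi0.incl (openTol_le_tol X ε hε)) := by
  refine ⟨Function.Injective.of_comp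
    (f := fun c => pi0Map (affineMap h) (Pi0.geometric _ c)) ?_, ?_⟩
  · convert (h.isOpenTolClosed.bijective_pi0Map.comp (Pi0.bijective_geometric _)).1 using 1
    funext c
    dsimp only [Function.comp]
    rw [Pi0.geometric_incl, pi0Map_affineMap_incl h.isOpenTolClosed h]
  · rintro ⟨v⟩
    exact ⟨Pi0.mk _ v, rfl⟩

theorem IsTolClosed.bijective_inclPi1 {hε : 0 < ε} (h : IsTolClosed X ε hε) (x : X) :
    Function.Bijective (Realization.inclPi1 (openTol_le_tol X ε hε) x) := by
  refine (Function.Bijective.of_comp_iff _ (Pi1.bijective_geometric _ x)).1 ?_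
  convert (Pi1.bijective_geometric _ x).comp (h.bijective_pi1Incl x) using 1
  exact funext fun g => (Pi1.geometric_incl _ x g).symm

theorem IsTolClosed.bijective_pi0Map_incl {hε : 0 < ε} (h : IsTolClosed X ε hε) :
    Function.Bijective (pi0Map (Realization.incl (openTol_le_tol X ε hε))) := by
  refine (Function.Bijective.of_comp_iff _ (Pi0.bijective_geometric _)).1 ?_
  convert (Pi0.bijective_geometric _).comp h.bijective_pi0Incl using 1
  exact funext fun g => (Pi0.geometric_incl _ g).symm

/-- Obtained by cancellation in the right-hand square, since the ball cover is not available for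
`t_εX`. -/
theorem IsTolClosed.bijective_affinePi1 {hε : 0 < ε} (h : IsTolClosed X ε hε) (x : X) :
    Function.Bijective (affinePi1 h hε x) := by
  refine (Function.Bijective.of_comp_iff _ (h.bijective_inclPi1 x)).1 ?_
  convert h.isOpenTolClosed.bijective_affinePi1 x using 1
  exact funext fun g => affinePi1_inclPi1 h.isOpenTolClosed h hε _ x g

theorem IsTolClosed.bijective_pi0Map {hε : 0 < ε} (h : IsTolClosed X ε hε) :
    Function.Bijective (pi0Map (affineMap h)) := by
  refine (Function.Bijective.of_comp_iff _ h.bijective_pi0Map_incl).1 ?_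
  convert h.isOpenTolClosed.bijective_pi0Map using 1
  exact funext fun c => pi0Map_affineMap_incl h.isOpenTolClosed h _ c

end Dilation

end CombSpace

end

/-! ### The open-spot comparison -/

theorem theorem7p5 {E : Type*} [NormedAddCommGroup E] [NormedSpace ℝ E] (X : Set E) (x₀ : X)
    (ε : ℝ) (hε : 0 < ε) :
    -- (a) `X` is `t_ε^-`-closed
    (∀ h : CombSpace.IsOpenTolClosed X ε hε,
      -- the isomorphism on `π₁`
      (∃ (Φ : CombSpace.Pi1 (CombSpace.openTol X ε hε) x₀ ≃*
            FundamentalGroup (CombSpace.Realization (CombSpace.openTol X ε hε))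
              (CombSpace.Realization.vertex _ x₀))
          (Ψ : CombSpace.Pi1 (CombSpace.openTol X ε hε) x₀ ≃*
            FundamentalGroup (CombSpace.openDilation X ε) (CombSpace.basePoint hε x₀)),
        CombSpace.IsComparison Φ ∧
        Function.Bijective (CombSpace.affinePi1 h hε x₀) ∧
        ∀ g, Ψ g = CombSpace.affinePi1 h hε x₀ (Φ g)) ∧
      -- the isomorphism on `π₀`
      (∃ (Φ : CombSpace.Pi0 (CombSpace.openTol X ε hε) ≃
            ZerothHomotopy (CombSpace.Realization (CombSpace.openTol X ε hε)))
          (Ψ : CombSpace.Pi0 (CombSpace.openTol X ε hε) ≃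
            ZerothHomotopy (CombSpace.openDilation X ε)),
        (∀ x, Φ (CombSpace.Pi0.mk _ x) = ZerothHomotopy.mk (CombSpace.Realization.vertex _ x)) ∧
        Function.Bijective (CombSpace.pi0Map (CombSpace.affineMap h)) ∧
        (∀ c, Ψ c = CombSpace.pi0Map (CombSpace.affineMap h) (Φ c)) ∧
        Ψ (CombSpace.Pi0.mk _ x₀) = ZerothHomotopy.mk (CombSpace.basePoint hε x₀))) ∧
    -- (b) `X` is also `t_ε`-closed
    (∀ h : CombSpace.IsTolClosed X ε hε,
      -- the commutative diagram of isomorphisms on `π₁`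
      (∃ (Φo : CombSpace.Pi1 (CombSpace.openTol X ε hε) x₀ ≃*
            FundamentalGroup (CombSpace.Realization (CombSpace.openTol X ε hε))
              (CombSpace.Realization.vertex _ x₀))
          (Φ : CombSpace.Pi1 (CombSpace.tol X ε hε) x₀ ≃*
            FundamentalGroup (CombSpace.Realization (CombSpace.tol X ε hε))
              (CombSpace.Realization.vertex _ x₀))
          (Ψ : CombSpace.Pi1 (CombSpace.tol X ε hε) x₀ ≃*
            FundamentalGroup (CombSpace.openDilation X ε) (CombSpace.basePoint hε x₀)),
        CombSpace.IsComparison Φo ∧ CombSpace.IsComparison Φ ∧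
        Function.Bijective (CombSpace.affinePi1 h.isOpenTolClosed hε x₀) ∧
        Function.Bijective (CombSpace.affinePi1 h hε x₀) ∧
        Function.Bijective (CombSpace.Pi1.incl (CombSpace.openTol_le_tol X ε hε) x₀) ∧
        Function.Bijective (CombSpace.Realization.inclPi1 (CombSpace.openTol_le_tol X ε hε) x₀) ∧
        (∀ g, Ψ g = CombSpace.affinePi1 h hε x₀ (Φ g)) ∧
        (∀ g, Φ (CombSpace.Pi1.incl (CombSpace.openTol_le_tol X ε hε) x₀ g) =
          CombSpace.Realization.inclPi1 (CombSpace.openTol_le_tol X ε hε) x₀ (Φo g)) ∧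
        (∀ g, CombSpace.affinePi1 h hε x₀
            (CombSpace.Realization.inclPi1 (CombSpace.openTol_le_tol X ε hε) x₀ g) =
          CombSpace.affinePi1 h.isOpenTolClosed hε x₀ g)) ∧
      -- the commutative diagram of bijections on `π₀`
      (∃ (Φo : CombSpace.Pi0 (CombSpace.openTol X ε hε) ≃
            ZerothHomotopy (CombSpace.Realization (CombSpace.openTol X ε hε)))
          (Φ : CombSpace.Pi0 (CombSpace.tol X ε hε) ≃
            ZerothHomotopy (CombSpace.Realization (CombSpace.tol X ε hε)))
          (Ψ : CombSpace.Pi0 (CombSpace.tol X ε hε) ≃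
            ZerothHomotopy (CombSpace.openDilation X ε)),
        (∀ x, Φo (CombSpace.Pi0.mk _ x) = ZerothHomotopy.mk (CombSpace.Realization.vertex _ x)) ∧
        (∀ x, Φ (CombSpace.Pi0.mk _ x) = ZerothHomotopy.mk (CombSpace.Realization.vertex _ x)) ∧
        Function.Bijective (CombSpace.pi0Map (CombSpace.affineMap h.isOpenTolClosed)) ∧
        Function.Bijective (CombSpace.pi0Map (CombSpace.affineMap h)) ∧
        Function.Bijective (CombSpace.Pi0.incl (CombSpace.openTol_le_tol X ε hε)) ∧
        Function.Bijective (CombSpace.pi0Map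
          (CombSpace.Realization.incl (CombSpace.openTol_le_tol X ε hε))) ∧
        (∀ c, Ψ c = CombSpace.pi0Map (CombSpace.affineMap h) (Φ c)) ∧
        (∀ c, Φ (CombSpace.Pi0.incl (CombSpace.openTol_le_tol X ε hε) c) =
          CombSpace.pi0Map (CombSpace.Realization.incl (CombSpace.openTol_le_tol X ε hε)) (Φo c)) ∧
        (∀ c, CombSpace.pi0Map (CombSpace.affineMap h)
            (CombSpace.pi0Map (CombSpace.Realization.incl (CombSpace.openTol_le_tol X ε hε)) c) =
          CombSpace.pi0Map (CombSpace.affineMap h.isOpenTolClosed) c) ∧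
        Ψ (CombSpace.Pi0.mk _ x₀) = ZerothHomotopy.mk (CombSpace.basePoint hε x₀))) := by
  refine ⟨fun h => ⟨?_, ?_⟩, fun h => ⟨?_, ?_⟩⟩
  · refine ⟨MulEquiv.ofBijective _ (CombSpace.Pi1.bijective_geometric _ x₀),
      MulEquiv.ofBijective ((CombSpace.affinePi1 h hε x₀).comp (CombSpace.Pi1.geometric _ x₀))
        ((h.bijective_affinePi1 x₀).comp (CombSpace.Pi1.bijective_geometric _ x₀)),
      fun a _ _ ha => CombSpace.Pi1.geometric_mk a ha, h.bijective_affinePi1 x₀, fun _ => rfl⟩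
  · exact ⟨Equiv.ofBijective _ (CombSpace.Pi0.bijective_geometric _),
      Equiv.ofBijective _ (h.bijective_pi0Map.comp (CombSpace.Pi0.bijective_geometric _)),
      fun _ => rfl, h.bijective_pi0Map, fun _ => rfl,
      congrArg ZerothHomotopy.mk (CombSpace.affineMap_vertex h hε x₀)⟩
  · exact ⟨MulEquiv.ofBijective _ (CombSpace.Pi1.bijective_geometric _ x₀),
      MulEquiv.ofBijective _ (CombSpace.Pi1.bijective_geometric _ x₀),
      MulEquiv.ofBijective ((CombSpace.affinePi1 h hε x₀).comp (CombSpace.Pi1.geometric _ x₀))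
        ((h.bijective_affinePi1 x₀).comp (CombSpace.Pi1.bijective_geometric _ x₀)),
      fun a _ _ ha => CombSpace.Pi1.geometric_mk a ha,
      fun a _ _ ha => CombSpace.Pi1.geometric_mk a ha,
      h.isOpenTolClosed.bijective_affinePi1 x₀, h.bijective_affinePi1 x₀,
      h.bijective_pi1Incl x₀, h.bijective_inclPi1 x₀, fun _ => rfl,
      CombSpace.Pi1.geometric_incl _ x₀,
      CombSpace.affinePi1_inclPi1 h.isOpenTolClosed h hε _ x₀⟩
  · exact ⟨Equiv.ofBijective _ (CombSpace.Pi0.bijective_geometric _),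
      Equiv.ofBijective _ (CombSpace.Pi0.bijective_geometric _),
      Equiv.ofBijective _ (h.bijective_pi0Map.comp (CombSpace.Pi0.bijective_geometric _)),
      fun _ => rfl, fun _ => rfl, h.isOpenTolClosed.bijective_pi0Map, h.bijective_pi0Map,
      h.bijective_pi0Incl, h.bijective_pi0Map_incl, fun _ => rfl,
      CombSpace.Pi0.geometric_incl _, CombSpace.pi0Map_affineMap_incl h.isOpenTolClosed h _,
      congrArg ZerothHomotopy.mk (CombSpace.affineMap_vertex h hε x₀)⟩
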